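/- Conventions. A binary tree is a set $T\subseteq 2^{<\omega}$ closed under initial segments; $[T]\subseteq 2^\omega$ is its set of infinite paths, and $T$ is *positive* if $[T]$ has positive measure for the fair coin (uniform product) measure. A binary tree $P$ is *perfect* if it is nonempty and every node of $P$ has two incomparable extensions in $P$. A tree $U'$ *end-extends* a tree $U\subseteq U'$ if every node of $U'$ is a node of $U$ or extends a leaf of $U$. Finite objects (strings, finite sets of strings, finite sequences) are coded by natural numbers in a standard effective way, and $A'$ denotes the Turing jump of $A$. Corollary 2.3. Let $T\subseteq 2^{<\omega}$ be a positive binary tree. (1) There is an infinite tree $\mathcal F\subseteq\omega^{<\omega}$ whose nodes are (codes of) finite sequences $(U_0,\dots,U_{n-1})$ of finite subtrees of $T$, each $U_{i+1}$ end-extending $U_i$, such that $\mathcal F$ is computable in $T$; $\mathcal F$ is computably bounded, i.e. there is a computable function $h:\omega\to\omega$ (without oracle) such that $s(i)\le h(i)$ for every $s\in\mathcal F$ and $i<|s|$; and for every infinite path $X=(U_0,U_1,\dots)$ of $\mathcal F$ the union $\bigcup X=\bigcup_n U_n$ is a positive perfect subtree of $T$. (2) For every set $A\subseteq\omega$ that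 computes $T'$ there is a positive perfect subtree $P\subseteq T$ such that $A$ is Turing equivalent to $T\oplus P$. -/

import Mathlib

open scoped Computability

namespace PerfTree

/-! ### Trees, paths, measure -/

/-- A tree over the alphabet `α`: a set of finite strings closed under initial segments
(`τ <+: σ` says that `τ` is an initial segment of `σ`).
Binary trees are the case `α = Bool`, trees in `ω^{<ω}` the case `α = ℕ`. -/
def IsTree {α : Type} (S : Set (List α)) : Prop :=
  ∀ σ τ : List α, τ <+: σ → σ ∈ S → τ ∈ S

/-- The set `[S]` of infinite paths of `S`: every finite initial segment
`x 0, …, x (n - 1)` lies in `S`. -/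
def paths {α : Type} (S : Set (List α)) : Set (ℕ → α) :=
  {x | ∀ n : ℕ, (List.range n).map x ∈ S}

/-- The fair coin measure (uniform product measure) on Cantor space `2^ω`. -/
noncomputable def coinMeasure : MeasureTheory.Measure (ℕ → Bool) :=
  MeasureTheory.Measure.infinitePi fun _ : ℕ => (PMF.uniformOfFintype Bool).toMeasure

/-- A binary tree is positive if its set of paths has positive measure. -/
def IsPositive (T : Set (List Bool)) : Prop :=
  0 < coinMeasure (paths T)

/-- A perfect binary tree: a nonempty tree in which every node has two incomparable extensions
(so in particular there are no dead ends, and it is the tree of initial segments of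
members of a nonempty perfect set). -/
def IsPerfectTree (P : Set (List Bool)) : Prop :=
  IsTree P ∧ P.Nonempty ∧ ∀ σ ∈ P, ∃ τ₀ ∈ P, ∃ τ₁ ∈ P,
    σ <+: τ₀ ∧ σ <+: τ₁ ∧ ¬ τ₀ <+: τ₁ ∧ ¬ τ₁ <+: τ₀

/-- `P` is a positive perfect subtree of `T`. -/
def IsPositivePerfectSubtree (P T : Set (List Bool)) : Prop :=
  IsPerfectTree P ∧ IsPositive P ∧ P ⊆ T

/-- `σ` is a leaf of `F`: a node without proper extension in `F`. -/
def IsLeaf (F : Set (List Bool)) (σ : List Bool) : Prop :=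
  σ ∈ F ∧ ∀ τ ∈ F, σ <+: τ → τ = σ

/-- `T` end-extends `F`, i.e. `F` is an initial segment of `T`: `F` is a subtree and every node
of `T` is a node of `F` or extends a leaf of `F`. -/
def EndExtends (T F : Set (List Bool)) : Prop :=
  IsTree T ∧ IsTree F ∧ F ⊆ T ∧ ∀ σ ∈ T, σ ∈ F ∨ ∃ τ, IsLeaf F τ ∧ τ <+: σ

/-! ### Oracle computability of sets -/

open Classical in
/-- The characteristic function of a set of natural numbers, as an oracle. -/
noncomputable def chi (A : Set ℕ) : ℕ →. ℕ :=
  fun n => Part.some (if n ∈ A then 1 else 0)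

/-- A set of finite objects viewed as the set of their codes. -/
def codes {α : Type} [Encodable α] (S : Set α) : Set ℕ :=
  Encodable.encode '' S

/-- `A` is computable in `B`. -/
def SetReducible (A B : Set ℕ) : Prop := chi A ≤ᵀ chi B

/-- `A` and `B` are Turing equivalent. -/
def SetEquivalent (A B : Set ℕ) : Prop := chi A ≡ᵀ chi B

/-- The join `A ⊕ B = {2n : n ∈ A} ∪ {2n+1 : n ∈ B}`. -/
def join (A B : Set ℕ) : Set ℕ :=
  (fun n => 2 * n) '' A ∪ (fun n => 2 * n + 1) '' B

/-- Programs for partial functions recursive in one oracle; the constructors are the closure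
conditions in the definition of `Nat.RecursiveIn`. -/
inductive OracleCode : Type
  | zero : OracleCode
  | succ : OracleCode
  | left : OracleCode
  | right : OracleCode
  | oracle : OracleCode
  | pair : OracleCode → OracleCode → OracleCode
  | comp : OracleCode → OracleCode → OracleCode
  | prec : OracleCode → OracleCode → OracleCode
  | rfind : OracleCode → OracleCode

namespace OracleCode

/-- The partial function computed by a program with oracle `g`. -/
def eval (g : ℕ →. ℕ) : OracleCode → ℕ →. ℕ
  | zero => fun _ => 0
  | succ => Nat.succ
  | left => fun n => ((Nat.unpair n).1 : ℕ)
  | right => fun n => ((Nat.unpair n).2 : ℕ)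
  | oracle => g
  | pair c d => fun n => Nat.pair <$> eval g c n <*> eval g d n
  | comp c d => fun n => eval g d n >>= eval g c
  | prec c d => fun p =>
      let (a, n) := Nat.unpair p
      n.rec (eval g c a) fun y IH => do
        let i ← IH
        eval g d (Nat.pair a (Nat.pair y i))
  | rfind c => fun a => Nat.rfind fun n => (fun m => m = 0) <$> eval g c (Nat.pair a n)

/-- The Gödel number of a program. -/
def index : OracleCode → ℕ
  | zero => 0
  | succ => 1
  | left => 2
  | right => 3
  | oracle => 4
  | pair c d => 4 * Nat.pair (index c) (index d) + 5
  | comp c d => 4 * Nat.pair (index c) (index d) + 6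
  | prec c d => 4 * Nat.pair (index c) (index d) + 7
  | rfind c => 4 * index c + 8

/-- Different programs have different Gödel numbers. -/
theorem index_injective : Function.Injective index := by
  intro c
  induction c with
  | zero | succ | left | right | oracle =>
    intro d h
    cases d <;> simp only [index] at h <;> first | rfl | omega
  | pair c₁ c₂ ih₁ ih₂ | comp c₁ c₂ ih₁ ih₂ | prec c₁ c₂ ih₁ ih₂ =>
    intro d h
    cases d with
    | pair d₁ d₂ | comp d₁ d₂ | prec d₁ d₂ =>
      simp only [index] at h
      first
      | omega
      | have h' := Nat.pair_eq_pair.1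
          (show Nat.pair (index c₁) (index c₂) = Nat.pair (index d₁) (index d₂) by omega)
        rw [ih₁ h'.1, ih₂ h'.2]
    | _ => simp only [index] at h; omega
  | rfind c ih =>
    intro d h
    cases d with
    | rfind d => simp only [index] at h; rw [ih (show index c = index d by omega)]
    | _ => simp only [index] at h; omega

/-- The programs compute exactly the partial functions recursive in the oracle. -/
theorem exists_eval_iff (f g : ℕ →. ℕ) : f ≤ᵀ g ↔ ∃ c : OracleCode, eval g c = f := by
  rw [TuringReducible, RecursiveIn.iff_nat]
  constructor
  · intro h
    induction h with
    | zero => exact ⟨zero, rfl⟩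
    | succ => exact ⟨succ, rfl⟩
    | left => exact ⟨left, rfl⟩
    | right => exact ⟨right, rfl⟩
    | oracle k hk => exact ⟨oracle, (Set.mem_singleton_iff.1 hk).symm⟩
    | pair _ _ ih₁ ih₂ =>
      obtain ⟨c, rfl⟩ := ih₁; obtain ⟨d, rfl⟩ := ih₂; exact ⟨pair c d, rfl⟩
    | comp _ _ ih₁ ih₂ =>
      obtain ⟨c, rfl⟩ := ih₁; obtain ⟨d, rfl⟩ := ih₂; exact ⟨comp c d, rfl⟩
    | prec _ _ ih₁ ih₂ =>
      obtain ⟨c, rfl⟩ := ih₁; obtain ⟨d, rfl⟩ := ih₂; exact ⟨prec c d, rfl⟩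
    | rfind _ ih => obtain ⟨c, rfl⟩ := ih; exact ⟨rfind c, rfl⟩
  · rintro ⟨c, rfl⟩
    induction c with
    | zero => exact .zero
    | succ => exact .succ
    | left => exact .left
    | right => exact .right
    | oracle => exact .oracle g rfl
    | pair _ _ ih₁ ih₂ => exact .pair ih₁ ih₂
    | comp _ _ ih₁ ih₂ => exact .comp ih₁ ih₂
    | prec _ _ ih₁ ih₂ => exact .prec ih₁ ih₂
    | rfind _ ih => exact .rfind ih

end OracleCode

/-- The Turing jump `A′ = {e : Φ_e^A(e) halts}`, where `Φ_e^A` is the function computed with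
oracle `A` by the program with Gödel number `e`. -/
def jump (A : Set ℕ) : Set ℕ :=
  {e | ∃ c : OracleCode, c.index = e ∧ (c.eval (chi A) e).Dom}

/-! ### Trees of finite binary trees -/

/-- The finite set of binary strings with canonical index `k`: the string `σ` is a member iff
the binary digit of `k` at the place numbered by the code of `σ` is `1`. -/
def finSet (k : ℕ) : Set (List Bool) :=
  {σ | k.testBit (Encodable.encode σ) = true}

/-- A tree of finite subtrees of `T`: a tree in `ω^{<ω}` whose nodes are (coded)
finite sequences of finite subtrees of `T`, each end-extending its predecessor. -/
def IsTreeOfFiniteSubtrees (F : Set (List ℕ)) (T : Set (List Bool)) : Prop :=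
  IsTree F ∧ ∀ s ∈ F,
    (∀ k ∈ s, IsTree (finSet k) ∧ finSet k ⊆ T) ∧
    s.IsChain fun k l => EndExtends (finSet l) (finSet k)

/-- A tree in `ω^{<ω}` is computably bounded if the entries of its nodes are bounded, place by
place, by a computable function (no oracle). -/
def ComputablyBounded (F : Set (List ℕ)) : Prop :=
  ∃ h : ℕ → ℕ, Computable h ∧ ∀ s ∈ F, ∀ (i : ℕ) (hi : i < s.length), s[i] ≤ h i

/-- The union `⋃ X` of a sequence of (coded) finite binary trees. -/
def pathUnion (X : ℕ → ℕ) : Set (List Bool) :=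
  ⋃ n, finSet (X n)

end PerfTree

open PerfTree

/-! ### Relative computability through finite oracle segments -/

namespace PerfTree

/-! The weight of a node is the limit density of `T` above it. Positivity gives `K` with `3 / 2 ^ K
≤ weight T []`. A subtree is built through sparse lengths `level K j`: each node of level `j` is
extended in all possible ways to the next length, and extensions of weight below `2 ^ (-(K + j +
1))` are dropped. Since the weights of the children average to the weight of the node, every node
keeps many extensions, and the total loss over all levels is so small that level `j` always contains
at least a `2 ^ (-K)` fraction of all strings of its length. There is even room to delete one more
node at each level (`exists_codedTower`).

A tower retains only finitary conditions: membership in `T`, the lower bound on the number of nodes,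
and splitting. These already force the generated tree to be positive and perfect
(`IsTower.isPositivePerfectSubtree`). They do not mention weights, so codes of finite towers form a
tree computable in `T`, computably bounded because the lengths are fixed in advance. Its infinite
paths are towers, and it is infinite because a tower exists.

For the second part, the optional deletion makes the size of level `j + 1` odd exactly when `j ∈ A`.
Being thin is enumerable in `T`, hence decidable from the jump (`setReducible_thin`), so `A`
computes the coded tree; conversely, counting nodes of the tree recovers `A`
(`setReducible_of_parity`). -/

open Classical in
/-- The initial segment of length `n` of the characteristic sequence of `A`. -/
noncomputable def segment (A : Set ℕ) (n : ℕ) : List Bool :=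
  (List.range n).map fun i => decide (i ∈ A)

theorem segment_getD (A : Set ℕ) {n i : ℕ} (h : i < n) :
    (segment A n).getD i false = true ↔ i ∈ A := by
  simp [segment, List.getD, h]

/-- A total function computable in the set `C`. -/
def TotalIn (C : Set ℕ) (f : ℕ → ℕ) : Prop :=
  Nat.RecursiveIn {chi C} fun n => Part.some (f n)

namespace TotalIn

variable {C : Set ℕ} {f g : ℕ → ℕ}

theorem of_primrec (hf : Nat.Primrec f) : TotalIn C f :=
  hf.recursiveIn

theorem comp (hf : TotalIn C f) (hg : TotalIn C g) : TotalIn C fun n => f (g n) :=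
  (Nat.RecursiveIn.comp hf hg).of_eq fun n => by simp

theorem pair (hf : TotalIn C f) (hg : TotalIn C g) : TotalIn C fun n => Nat.pair (f n) (g n) :=
  (Nat.RecursiveIn.pair hf hg).of_eq fun n => by simp [Seq.seq]

theorem map₂ {F : ℕ → ℕ → ℕ} (hF : Primrec₂ F) (hf : TotalIn C f) (hg : TotalIn C g) :
    TotalIn C fun n => F (f n) (g n) := by
  have := (of_primrec (C := C) (Primrec₂.unpaired'.2 hF)).comp (hf.pair hg)
  simpa [Nat.unpaired] using this

theorem prec {h : ℕ → ℕ} (hf : TotalIn C f) (hh : TotalIn C h) :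
    TotalIn C fun p => Nat.rec (f p.unpair.1)
      (fun y i => h (Nat.pair p.unpair.1 (Nat.pair y i))) p.unpair.2 :=
  (Nat.RecursiveIn.prec hf hh).of_eq fun p => by
    simp only
    induction p.unpair.2 with
    | zero => rfl
    | succ n ih => simp only [ih]; simp

end TotalIn

open Classical in
theorem setReducible_iff {A C : Set ℕ} :
    SetReducible A C ↔ TotalIn C fun n => if n ∈ A then 1 else 0 := by
  rw [SetReducible, TuringReducible, RecursiveIn.iff_nat]; rfl

theorem SetReducible.trans {A B C : Set ℕ} (h₁ : SetReducible A B) (h₂ : SetReducible B C) :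
    SetReducible A C :=
  TuringReducible.trans h₁ h₂

/-- One oracle query per digit, by primitive recursion. Packing the oracle's answers into one number
lets the rest of a computation be plainly primitive recursive. -/
theorem SetReducible.segment {A C : Set ℕ} (h : SetReducible A C) :
    TotalIn C fun n => Encodable.encode (segment A n) := by
  classical
  have step : Primrec₂ fun (p χ : ℕ) => Encodable.encode
      (((Encodable.decode (α := List Bool) p.unpair.2.unpair.2).getD []) ++ [χ == 1]) := by
    refine Primrec.encode.comp (Primrec.list_concat.comp (Primrec.option_getD.comp
      (Primrec.decode.comp ?_) (Primrec.const [])) ?_)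
    · exact Primrec.snd.comp (Primrec.unpair.comp (Primrec.snd.comp
        (Primrec.unpair.comp Primrec.fst)))
    · exact Primrec.beq.comp Primrec.snd (Primrec.const 1)
  have hy : Nat.Primrec fun p : ℕ => p.unpair.2.unpair.1 :=
    Primrec.nat_iff.1 (Primrec.fst.comp (Primrec.unpair.comp (Primrec.snd.comp Primrec.unpair)))
  have h₁ := (setReducible_iff.1 h).comp (TotalIn.of_primrec hy)
  have h₂ := TotalIn.map₂ step (TotalIn.of_primrec Nat.Primrec.id) h₁
  have h₃ := TotalIn.prec (TotalIn.of_primrec (Nat.Primrec.const (Encodable.encode ([] : List Bool)))) h₂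
  have h₄ := h₃.comp ((TotalIn.of_primrec (Nat.Primrec.const 0)).pair
    (TotalIn.of_primrec Nat.Primrec.id))
  convert h₄ using 2 with n
  simp only [Nat.unpair_pair, id]
  induction n with
  | zero => rfl
  | succ n ih =>
    simp only [← ih, Encodable.encodek, Option.getD_some]
    simp only [PerfTree.segment, List.range_succ, List.map_append, List.map_cons, List.map_nil]
    by_cases hn : n ∈ A <;> simp [hn]

/-- Reductions whose oracle queries are bounded in advance. -/
theorem SetReducible.of_segments {α : Type} [Primcodable α] {S : Set α} {A B C : Set ℕ}
    {u : α → ℕ} {F : α → List Bool × List Bool → Bool} (hA : SetReducible A C)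
    (hB : SetReducible B C) (hu : Primrec u) (hF : Primrec₂ F)
    (h : ∀ a, a ∈ S ↔ F a (PerfTree.segment A (u a), PerfTree.segment B (u a)) = true) :
    SetReducible (codes S) C := by
  classical
  -- `decode₂` succeeds only on genuine codes, so numbers that code nothing are rejected by the
  -- defaults.
  let v : ℕ → ℕ := fun n => ((Encodable.decode₂ α n).map u).getD 0
  have hv : Primrec v := Primrec.option_getD.comp
    (Primrec.option_map Primrec.decode₂ (hu.comp Primrec.snd).to₂) (Primrec.const 0)
  have hvT : TotalIn C v := TotalIn.of_primrec (Primrec.nat_iff.1 hv)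
  have hs := (hA.segment.comp hvT).pair (hB.segment.comp hvT)
  let G : ℕ → ℕ → ℕ := fun n k =>
    (((Encodable.decode₂ α n).map fun a =>
      F a ((Encodable.decode (α := List Bool × List Bool) k).getD ([], []))).getD false).toNat
  have hG : Primrec₂ G := by
    refine (Primrec.dom_bool Bool.toNat).comp (Primrec.option_getD.comp (Primrec.option_map
      (Primrec.decode₂.comp Primrec.fst) (hF.comp Primrec.snd (Primrec.option_getD.comp
        (Primrec.decode.comp (Primrec.snd.comp Primrec.fst)) (Primrec.const ([], [])))).to₂)
      (Primrec.const false))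
  rw [setReducible_iff]
  convert TotalIn.map₂ hG (TotalIn.of_primrec Nat.Primrec.id) hs using 2 with n
  simp only [id, G, v]
  by_cases hn : n ∈ codes S
  · obtain ⟨a, ha, rfl⟩ := hn
    have := (h a).1 ha
    rw [if_pos ⟨a, ha, rfl⟩]
    simp [← Encodable.encode_prod_val, this]
  · rw [if_neg hn]
    rcases hd : Encodable.decode₂ α n with _ | a
    · simp
    · obtain rfl := Encodable.decode₂_eq_some.1 hd
      have hF' : F a (PerfTree.segment A (u a), PerfTree.segment B (u a)) = false := by
        rw [← Bool.not_eq_true, ← h]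
        exact fun ha => hn ⟨a, ha, rfl⟩
      simp [← Encodable.encode_prod_val, hF']

theorem SetReducible.of_segment {α : Type} [Primcodable α] {S : Set α} {A C : Set ℕ}
    {u : α → ℕ} {F : α → List Bool → Bool} (hA : SetReducible A C) (hu : Primrec u)
    (hF : Primrec₂ F) (h : ∀ a, a ∈ S ↔ F a (PerfTree.segment A (u a)) = true) :
    SetReducible (codes S) C :=
  .of_segments hA hA hu (F := fun a p => F a p.1)
    (hF.comp Primrec.fst (Primrec.fst.comp Primrec.snd)) h

theorem SetReducible.refl (A : Set ℕ) : SetReducible A A :=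
  TuringReducible.refl _

theorem codes_nat (A : Set ℕ) : codes A = A := by
  simp [codes]

theorem SetReducible.compl {A C : Set ℕ} (h : SetReducible A C) : SetReducible Aᶜ C := by
  have hF : Primrec₂ fun (n : ℕ) (l : List Bool) => !(l.getD n false) :=
    Primrec.not.comp ((Primrec.list_getD false).comp Primrec.snd Primrec.fst)
  rw [← codes_nat Aᶜ]
  refine .of_segment h Primrec.succ hF fun n => ?_
  rw [Set.mem_compl_iff, ← segment_getD A (Nat.lt_succ_self n), Bool.not_eq_true', Bool.not_eq_true]

theorem SetReducible.preimage {A C : Set ℕ} (h : SetReducible A C) {f : ℕ → ℕ} (hf : Primrec f) :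
    SetReducible (f ⁻¹' A) C := by
  classical
  rw [setReducible_iff] at h ⊢
  exact h.comp (TotalIn.of_primrec (Primrec.nat_iff.1 hf))

theorem mem_join_iff {A B : Set ℕ} {n : ℕ} :
    n ∈ join A B ↔ if n % 2 = 0 then n / 2 ∈ A else n / 2 ∈ B := by
  unfold join
  constructor
  · rintro (⟨k, hk, rfl⟩ | ⟨k, hk, rfl⟩)
    · simpa using hk
    · have : (2 * k + 1) / 2 = k := by omega
      simpa [this, Nat.add_mod] using hk
  · split_ifs with h
    · exact fun hn => .inl ⟨_, hn, by dsimp only; omega⟩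
    · exact fun hn => .inr ⟨_, hn, by dsimp only; omega⟩

theorem SetReducible.join {A B C : Set ℕ} (hA : SetReducible A C) (hB : SetReducible B C) :
    SetReducible (join A B) C := by
  have hF : Primrec₂ fun (n : ℕ) (p : List Bool × List Bool) =>
      if n % 2 = 0 then p.1.getD (n / 2) false else p.2.getD (n / 2) false := by
    have hn : Primrec fun x : ℕ × List Bool × List Bool => x.1 / 2 :=
      Primrec.nat_div.comp Primrec.fst (Primrec.const 2)
    exact Primrec.ite (Primrec.eq.comp (Primrec.nat_mod.comp Primrec.fst (Primrec.const 2))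
      (Primrec.const 0))
      ((Primrec.list_getD false).comp (Primrec.fst.comp Primrec.snd) hn)
      ((Primrec.list_getD false).comp (Primrec.snd.comp Primrec.snd) hn)
  rw [← codes_nat (PerfTree.join A B)]
  refine .of_segments hA hB Primrec.succ hF fun n => ?_
  have : n / 2 < n.succ := by omega
  rw [mem_join_iff, ← segment_getD A this, ← segment_getD B this]
  split_ifs <;> rfl

theorem SetReducible.join_right (A B : Set ℕ) : SetReducible B (PerfTree.join A B) := by
  have : B = (fun n => 2 * n + 1) ⁻¹' PerfTree.join A B := by
    ext n
    have : (2 * n + 1) / 2 = n := by omega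
    simp [mem_join_iff, this, Nat.add_mod]
  conv_lhs => rw [this]
  exact (SetReducible.refl _).preimage Primrec.nat_double_succ

/-! ### The jump -/

/-- The program that ignores its input and returns `n`. -/
def OracleCode.const : ℕ → OracleCode
  | 0 => .zero
  | n + 1 => .comp .succ (OracleCode.const n)

@[simp] theorem OracleCode.eval_const (g : ℕ →. ℕ) (n e : ℕ) :
    (OracleCode.const n).eval g e = Part.some n := by
  induction n with
  | zero => rfl
  | succ n ih =>
    simp only [OracleCode.const, OracleCode.eval, ih]
    exact Part.bind_some n _

theorem OracleCode.primrec_index_const : Primrec fun n => (OracleCode.const n).index := by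
  have : Primrec (Nat.rec 0 fun _ i => 4 * Nat.pair 1 i + 6 : ℕ → ℕ) :=
    Primrec.nat_rec₁ 0 (Primrec.nat_add.comp (Primrec.nat_mul.comp (Primrec.const 4)
      (Primrec₂.natPair.comp (Primrec.const 1) Primrec.snd)) (Primrec.const 6))
  refine this.of_eq fun n => ?_
  induction n with
  | zero => rfl
  | succ n ih => simp only [OracleCode.const, OracleCode.index, ← ih]

/-- The jump decides the sets that are enumerable in the oracle. -/
theorem SetReducible.exists_pair_jump {Q B : Set ℕ} (hQ : SetReducible Q B) :
    SetReducible {n | ∃ m, Nat.pair n m ∈ Q} (jump B) := by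
  classical
  -- The complement is used because `rfind` searches for the value `0`.
  obtain ⟨c, hc⟩ := (OracleCode.exists_eval_iff _ _).1 hQ.compl
  -- The program ignores its input, so running it on its own index still searches for a witness for
  -- `n`.
  have hf : Primrec fun n => ((OracleCode.rfind c).comp (OracleCode.const n)).index := by
    have := Primrec.nat_add.comp (Primrec.nat_mul.comp (Primrec.const 4)
      (Primrec₂.natPair.comp (Primrec.const (OracleCode.rfind c).index)
        OracleCode.primrec_index_const)) (Primrec.const 6)
    exact this
  convert (SetReducible.refl (jump B)).preimage hf using 1
  ext n
  have key : (((OracleCode.rfind c).comp (OracleCode.const n)).eval (chi B)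
      ((OracleCode.rfind c).comp (OracleCode.const n)).index).Dom ↔ ∃ m, Nat.pair n m ∈ Q := by
    simp only [OracleCode.eval, OracleCode.eval_const, hc, Part.bind_eq_bind, Part.bind_some]
    refine Nat.rfind_dom.trans ?_
    simp [chi]
  rw [Set.mem_preimage]
  constructor
  · intro h
    exact ⟨_, rfl, key.2 h⟩
  · rintro ⟨d, hd, hdom⟩
    rw [OracleCode.index_injective hd] at hdom
    exact key.1 hdom

theorem SetReducible.jump_self (B : Set ℕ) : SetReducible B (jump B) := by
  have h : SetReducible ((fun n => n.unpair.1) ⁻¹' B) B :=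
    (SetReducible.refl B).preimage (Primrec.fst.comp Primrec.unpair)
  simpa using h.exists_pair_jump

end PerfTree

namespace PerfTree

/-! ### Binary strings of a given length -/

/-- The binary strings of length `n`. -/
def strings : ℕ → List (List Bool)
  | 0 => [[]]
  | n + 1 => (strings n).map (false :: ·) ++ (strings n).map (true :: ·)

theorem mem_strings {n : ℕ} {σ : List Bool} : σ ∈ strings n ↔ σ.length = n := by
  induction n generalizing σ with
  | zero => simp [strings]
  | succ n ih =>
    rcases σ with _ | ⟨_ | _, σ⟩ <;> simp [strings, ih]

theorem nodup_strings (n : ℕ) : (strings n).Nodup := by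
  induction n with
  | zero => simp [strings]
  | succ n ih =>
    refine List.nodup_append.2 ⟨ih.map fun _ _ h => by simpa using h,
      ih.map fun _ _ h => by simpa using h, ?_⟩
    simp

theorem length_strings (n : ℕ) : (strings n).length = 2 ^ n := by
  induction n with
  | zero => rfl
  | succ n ih => simp [strings, ih, pow_succ]; ring

open Classical in
/-- The number of nodes of `T` that extend `σ` by `n` digits. -/
noncomputable def extCount (T : Set (List Bool)) (σ : List Bool) (n : ℕ) : ℕ :=
  (strings n).countP fun ρ => decide (σ ++ ρ ∈ T)

open Classical in
theorem extCount_succ (T : Set (List Bool)) (σ : List Bool) (n : ℕ) :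
    extCount T σ (n + 1) = extCount T (σ ++ [false]) n + extCount T (σ ++ [true]) n := by
  have h : ∀ b : Bool, (strings n).countP (fun ρ => decide (σ ++ b :: ρ ∈ T))
      = extCount T (σ ++ [b]) n := fun b => List.countP_congr fun ρ _ => by simp
  simp only [strings, extCount.eq_1 T σ, List.countP_append, List.countP_map, Function.comp_def, h]

theorem extCount_zero_le (T : Set (List Bool)) (σ : List Bool) : extCount T σ 0 ≤ 1 := by
  unfold extCount
  exact List.countP_le_length

theorem extCount_zero_of_mem {T : Set (List Bool)} {σ : List Bool} (h : σ ∈ T) :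
    extCount T σ 0 = 1 := by
  simp [extCount, strings, h]

theorem extCount_zero_of_notMem {T : Set (List Bool)} {σ : List Bool} (h : σ ∉ T) :
    extCount T σ 0 = 0 := by
  simp [extCount, strings, h]

/-- Makes the densities decreasing, so that their infimum `weight` is a limit and passes through
sums. -/
theorem extCount_succ_le {T : Set (List Bool)} (hT : IsTree T) (σ : List Bool) (n : ℕ) :
    extCount T σ (n + 1) ≤ 2 * extCount T σ n := by
  induction n generalizing σ with
  | zero =>
    by_cases h : σ ∈ T
    · rw [extCount_succ, extCount_zero_of_mem h]
      linarith [extCount_zero_le T (σ ++ [false]), extCount_zero_le T (σ ++ [true])]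
    · have h' : ∀ b : Bool, σ ++ [b] ∉ T := fun b hb => h (hT _ _ (List.prefix_append _ _) hb)
      rw [extCount_succ, extCount_zero_of_notMem (h' _), extCount_zero_of_notMem (h' _)]
      simp
  | succ n ih =>
    rw [extCount_succ T σ (n + 1), extCount_succ T σ n]
    linarith [ih (σ ++ [false]), ih (σ ++ [true])]

/-! ### The relative measure of a tree above a node -/

/-- The limit density of `T` above `σ`. -/
noncomputable def weight (T : Set (List Bool)) (σ : List Bool) : ℝ :=
  ⨅ n : ℕ, (extCount T σ n : ℝ) / 2 ^ n

theorem bddBelow_density (T : Set (List Bool)) (σ : List Bool) :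
    BddBelow (Set.range fun n : ℕ => (extCount T σ n : ℝ) / 2 ^ n) :=
  ⟨0, by rintro _ ⟨n, rfl⟩; positivity⟩

theorem weight_le (T : Set (List Bool)) (σ : List Bool) (n : ℕ) :
    weight T σ ≤ (extCount T σ n : ℝ) / 2 ^ n :=
  ciInf_le (bddBelow_density T σ) n

theorem le_weight {T : Set (List Bool)} {σ : List Bool} {c : ℝ}
    (h : ∀ n, c ≤ (extCount T σ n : ℝ) / 2 ^ n) : c ≤ weight T σ :=
  le_ciInf h

theorem weight_le_one (T : Set (List Bool)) (σ : List Bool) : weight T σ ≤ 1 := by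
  refine (weight_le T σ 0).trans ?_
  simpa using extCount_zero_le T σ

theorem mem_of_weight_pos {T : Set (List Bool)} {σ : List Bool} (h : 0 < weight T σ) : σ ∈ T := by
  by_contra hσ
  have := weight_le T σ 0
  rw [extCount_zero_of_notMem hσ] at this
  simp only [Nat.cast_zero, zero_div] at this
  linarith

theorem tendsto_weight {T : Set (List Bool)} (hT : IsTree T) (σ : List Bool) :
    Filter.Tendsto (fun n : ℕ => (extCount T σ n : ℝ) / 2 ^ n) Filter.atTop
      (nhds (weight T σ)) := by
  refine tendsto_atTop_ciInf (antitone_nat_of_succ_le fun n => ?_) (bddBelow_density T σ)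
  rw [div_le_div_iff₀ (by positivity) (by positivity), pow_succ]
  have : (extCount T σ (n + 1) : ℝ) ≤ 2 * extCount T σ n := by
    exact_mod_cast extCount_succ_le hT σ n
  nlinarith [show (0 : ℝ) < 2 ^ n by positivity]

theorem weight_split {T : Set (List Bool)} (hT : IsTree T) (σ : List Bool) :
    weight T (σ ++ [false]) + weight T (σ ++ [true]) = 2 * weight T σ := by
  have h := ((tendsto_weight hT σ).comp (Filter.tendsto_add_atTop_nat 1)).const_mul 2
  refine tendsto_nhds_unique ((tendsto_weight hT _).add (tendsto_weight hT _)) (h.congr fun n => ?_)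
  simp only [Function.comp, extCount_succ, pow_succ]
  push_cast
  field_simp

theorem sum_weight_strings {T : Set (List Bool)} (hT : IsTree T) (σ : List Bool) (d : ℕ) :
    ((strings d).map fun ρ => weight T (σ ++ ρ)).sum = 2 ^ d * weight T σ := by
  induction d generalizing σ with
  | zero => simp [strings]
  | succ d ih =>
    have h : ∀ b : Bool, ((strings d).map fun ρ => weight T (σ ++ b :: ρ)).sum
        = 2 ^ d * weight T (σ ++ [b]) := fun b => by simp [← ih]
    simp only [strings, List.map_append, List.map_map, List.sum_append, Function.comp_def, h]
    rw [← mul_add, weight_split hT, pow_succ, mul_assoc]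

/-- The pairs `(σ, e)` such that the limit density of `T` above `σ` is below `2 ^ (-e)`. -/
def thin (T : Set (List Bool)) : Set (List Bool × ℕ) :=
  {p | ∃ n, 2 ^ p.2 * extCount T p.1 n < 2 ^ n}

/-- Densities decrease to the weight, so a small weight is witnessed at a finite stage; this makes
thinness enumerable in `T`. -/
theorem weight_le_of_mem_thin {T : Set (List Bool)} {σ : List Bool} {e : ℕ}
    (h : (σ, e) ∈ thin T) : weight T σ ≤ 1 / 2 ^ e := by
  obtain ⟨n, hn⟩ := h
  refine (weight_le T σ n).trans ?_
  rw [div_le_div_iff₀ (by positivity) (by positivity), one_mul, mul_comm]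
  exact_mod_cast hn.le

theorem le_weight_of_notMem_thin {T : Set (List Bool)} {σ : List Bool} {e : ℕ}
    (h : (σ, e) ∉ thin T) : 1 / 2 ^ e ≤ weight T σ := by
  refine le_weight fun n => ?_
  rw [div_le_div_iff₀ (by positivity) (by positivity), one_mul, mul_comm]
  simp only [thin, Set.mem_ofPred_eq, not_exists, not_lt] at h
  exact_mod_cast h n

/-! ### Cantor space -/

theorem coinMeasure_cylinder (σ : List Bool) :
    coinMeasure {x | (List.range σ.length).map x = σ} = (2 ^ σ.length)⁻¹ := by
  have : {x : ℕ → Bool | (List.range σ.length).map x = σ} =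
      Set.pi (Finset.range σ.length) fun i => {σ.getD i false} := by
    ext x
    simp only [Set.mem_ofPred_eq, Set.mem_pi, Finset.coe_range, Set.mem_Iio, Set.mem_singleton_iff]
    constructor
    · intro h i hi
      rw [← h]
      simp [List.getD, hi]
    · intro h
      refine List.ext_getElem (by simp) fun i h₁ h₂ => ?_
      simp [h i h₂, h₂]
  rw [this, coinMeasure, MeasureTheory.Measure.infinitePi_pi _ (fun i _ => measurableSet_singleton _)]
  simp [ENNReal.inv_pow]

open Classical in
theorem coinMeasure_level (S : Set (List Bool)) (n : ℕ) :
    coinMeasure {x | (List.range n).map x ∈ S} = extCount S [] n * (2 ^ n)⁻¹ := by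
  have : {x : ℕ → Bool | (List.range n).map x ∈ S} =
      ⋃ σ ∈ ((strings n).filter fun σ => decide (σ ∈ S)).toFinset,
        {x | (List.range σ.length).map x = σ} := by
    ext x
    simp only [Set.mem_ofPred_eq, Set.mem_iUnion, List.mem_toFinset, List.mem_filter, mem_strings,
      decide_eq_true_eq, exists_prop]
    constructor
    · exact fun h => ⟨_, ⟨by simp, h⟩, by simp⟩
    · rintro ⟨σ, ⟨rfl, hσ⟩, h⟩
      rwa [h]
  have hmeas : ∀ σ : List Bool, MeasurableSet {x : ℕ → Bool | (List.range σ.length).map x = σ} := by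
    intro σ
    have : Measurable fun x : ℕ → Bool => fun i : Fin σ.length => x i := by fun_prop
    convert this (measurableSet_singleton fun i => σ[i]) using 1
    ext x
    simp only [Set.mem_ofPred_eq, Set.mem_preimage, Set.mem_singleton_iff, funext_iff]
    constructor
    · intro h i
      have := List.getElem_of_eq h.symm i.2
      simpa using this.symm
    · exact fun h => List.ext_getElem (by simp) fun i h₁ h₂ => by simpa using h ⟨i, h₂⟩
  rw [this, MeasureTheory.measure_biUnion_finset _ fun σ _ => hmeas σ]
  · have : ∀ σ ∈ ((strings n).filter fun σ => decide (σ ∈ S)).toFinset,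
        coinMeasure {x | (List.range σ.length).map x = σ} = (2 ^ n)⁻¹ := by
      intro σ hσ
      rw [coinMeasure_cylinder]
      simp only [List.mem_toFinset, List.mem_filter, mem_strings] at hσ
      rw [hσ.1]
    rw [Finset.sum_congr rfl this, Finset.sum_const,
      List.toFinset_card_of_nodup ((nodup_strings n).filter _), nsmul_eq_mul]
    simp [extCount, List.countP_eq_length_filter]
  · intro σ hσ τ hτ hne
    simp only [List.coe_toFinset, List.mem_filter, mem_strings, Set.mem_ofPred_eq] at hσ hτ
    refine Set.disjoint_left.2 fun x hx hx' => hne ?_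
    simp only [Set.mem_ofPred_eq] at hx hx'
    rw [← hx, ← hx', hσ.1, hτ.1]

/-- The measure of `paths T` is below that of every level set, hence below the infimum of the
densities. -/
theorem weight_nil_pos {T : Set (List Bool)} (hpos : IsPositive T) : 0 < weight T [] := by
  have hfin : coinMeasure (paths T) ≠ ⊤ := by
    have : coinMeasure (paths T) ≤ coinMeasure {x | (List.range 0).map x ∈ T} :=
      MeasureTheory.measure_mono fun x hx => hx 0
    refine ne_top_of_le_ne_top ?_ this
    rw [coinMeasure_level]
    simp
  refine lt_of_lt_of_le (ENNReal.toReal_pos hpos.ne' hfin) (le_weight fun n => ?_)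
  have : coinMeasure (paths T) ≤ coinMeasure {x | (List.range n).map x ∈ T} :=
    MeasureTheory.measure_mono fun x hx => hx n
  rw [coinMeasure_level] at this
  have h := ENNReal.toReal_mono (by finiteness) this
  simpa [div_eq_mul_inv] using h

/-- Continuity from above: `paths P` is the decreasing intersection of its level sets, so bounds at
arbitrarily large lengths suffice. -/
theorem isPositive_of_le {P : Set (List Bool)} (hP : IsTree P) {K : ℕ}
    (h : ∀ n, ∃ m ≥ n, 2 ^ m ≤ 2 ^ K * extCount P [] m) : IsPositive P := by
  have hpaths : paths P = ⋂ n, {x | (List.range n).map x ∈ P} := by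
    ext; simp [paths]
  have hanti : Antitone fun n => {x : ℕ → Bool | (List.range n).map x ∈ P} := by
    refine antitone_nat_of_succ_le fun n x hx => hP _ _ ?_ hx
    rw [List.range_succ, List.map_append]
    exact List.prefix_append _ _
  have hmeas : ∀ n, MeasurableSet {x : ℕ → Bool | (List.range n).map x ∈ P} := by
    intro n
    have : Measurable fun x : ℕ → Bool => fun i : Fin n => x i := by fun_prop
    convert this ((Set.toFinite {y : Fin n → Bool | List.ofFn y ∈ P}).measurableSet) using 1
    ext x
    simp only [Set.mem_ofPred_eq, Set.mem_preimage]
    rw [show (List.range n).map x = List.ofFn fun i : Fin n => x i from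
      List.ext_getElem (by simp) (by simp)]
  have hlim := MeasureTheory.tendsto_measure_iInter_atTop (μ := coinMeasure)
    (fun n => (hmeas n).nullMeasurableSet) hanti
    ⟨0, by rw [coinMeasure_level]; finiteness⟩
  rw [← hpaths] at hlim
  have hK : ((2 : ENNReal) ^ K)⁻¹ ≤ coinMeasure (paths P) := by
    refine ge_of_tendsto' hlim fun n => ?_
    obtain ⟨m, hm, hcount⟩ := h n
    refine le_trans ?_ (MeasureTheory.measure_mono (hanti hm))
    simp only
    rw [coinMeasure_level, ENNReal.inv_le_iff_le_mul (by simp) (by simp), ← mul_assoc,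
      ← div_eq_mul_inv, ENNReal.le_div_iff_mul_le (by simp) (by simp), one_mul]
    exact_mod_cast hcount
  exact lt_of_lt_of_le (by simp) hK

end PerfTree

namespace PerfTree

/-! ### Trees generated by their nodes on sparse levels -/

/-- The length of the strings on the `j`-th splitting level. -/
def level (K j : ℕ) : ℕ := j * (j + K + 2)

theorem level_mono (K : ℕ) : Monotone (level K) := fun _ _ h => by
  unfold level; gcongr

theorem le_level (K j : ℕ) : j ≤ level K j := by
  unfold level; nlinarith

/-- The increment lets a node of weight at least `2 ^ (-(K + j))` keep `2 ^ (j + 2)` extensions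
after the thin ones are dropped. -/
theorem level_succ (K j : ℕ) : level K (j + 1) = level K j + (2 * j + K + 3) := by
  unfold level; ring

/-- The requirements on a single splitting level. -/
structure IsTowerLevel (T : Set (List Bool)) (K j : ℕ) (M : List (List Bool)) : Prop where
  nodup : M.Nodup
  length_eq : ∀ σ ∈ M, σ.length = level K j
  mem : ∀ σ ∈ M, σ ∈ T
  measure : 2 ^ level K j ≤ 2 ^ K * M.length

/-- The requirements on two consecutive splitting levels. -/
structure IsTowerStep (K j : ℕ) (M N : List (List Bool)) : Prop where
  take_mem : ∀ τ ∈ N, τ.take (level K j) ∈ M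
  split : ∀ σ ∈ M, 2 ≤ N.countP fun τ => decide (σ <+: τ)

/-- Splitting levels of a positive perfect subtree of `T`. -/
def IsTower (T : Set (List Bool)) (K : ℕ) (M : ℕ → List (List Bool)) : Prop :=
  ∀ j, IsTowerLevel T K j (M j) ∧ IsTowerStep K j (M j) (M (j + 1))

/-- The initial segments of the members of a list of strings. -/
def downClosure (M : List (List Bool)) : Set (List Bool) :=
  {σ | ∃ τ ∈ M, σ <+: τ}

/-- The tree with the given splitting levels. -/
def towerTree (M : ℕ → List (List Bool)) : Set (List Bool) :=
  ⋃ j, downClosure (M j)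

theorem isTree_downClosure (M : List (List Bool)) : IsTree (downClosure M) :=
  fun _ _ h ⟨ρ, hρ, hσ⟩ => ⟨ρ, hρ, h.trans hσ⟩

theorem mem_downClosure_iff {T : Set (List Bool)} {K j : ℕ} {M : List (List Bool)}
    (hM : IsTowerLevel T K j M) {σ : List Bool} (hσ : σ.length = level K j) :
    σ ∈ downClosure M ↔ σ ∈ M := by
  refine ⟨fun ⟨τ, hτ, h⟩ => ?_, fun h => ⟨σ, h, List.prefix_rfl⟩⟩
  rwa [h.eq_of_length (hσ.trans (hM.length_eq τ hτ).symm)]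

theorem IsTowerStep.downClosure_subset {K j : ℕ} {M N : List (List Bool)}
    (h : IsTowerStep K j M N) : downClosure M ⊆ downClosure N := by
  rintro σ ⟨τ, hτ, hσ⟩
  obtain ⟨ρ, hρ, hτρ⟩ := List.countP_pos_iff.1 (lt_of_lt_of_le (by norm_num) (h.split τ hτ))
  exact ⟨ρ, hρ, hσ.trans (of_decide_eq_true hτρ)⟩

theorem IsTowerStep.mem_downClosure_of_le {K j : ℕ} {M N : List (List Bool)}
    (h : IsTowerStep K j M N) {σ : List Bool} (hσ : σ ∈ downClosure N)
    (hlen : σ.length ≤ level K j) : σ ∈ downClosure M := by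
  obtain ⟨τ, hτ, hστ⟩ := hσ
  exact ⟨_, h.take_mem τ hτ, List.prefix_take_iff.2 ⟨hστ, hlen⟩⟩

/-- Distinct strings of equal length are incomparable. -/
theorem IsTowerStep.exists_split {T : Set (List Bool)} {K j : ℕ} {M N : List (List Bool)}
    (h : IsTowerStep K j M N) (hN : IsTowerLevel T K (j + 1) N) {σ : List Bool} (hσ : σ ∈ M) :
    ∃ τ₀ ∈ N, ∃ τ₁ ∈ N, σ <+: τ₀ ∧ σ <+: τ₁ ∧ ¬ τ₀ <+: τ₁ ∧ ¬ τ₁ <+: τ₀ := by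
  have h₂ := h.split σ hσ
  rw [List.countP_eq_length_filter] at h₂
  have hnd := hN.nodup.filter fun τ => decide (σ <+: τ)
  have hmem : ∀ τ ∈ N.filter fun τ => decide (σ <+: τ), τ ∈ N ∧ σ <+: τ := fun τ hτ => by
    simpa using hτ
  revert h₂ hnd hmem
  generalize N.filter (fun τ => decide (σ <+: τ)) = L
  intro h₂ hnd hmem
  match L, h₂ with
  | τ₀ :: τ₁ :: _, _ =>
    have h₀ := hmem τ₀ (by simp)
    have h₁ := hmem τ₁ (by simp)
    have hne : τ₀ ≠ τ₁ := by rintro rfl; simp at hnd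
    have hlen := (hN.length_eq _ h₀.1).trans (hN.length_eq _ h₁.1).symm
    exact ⟨τ₀, h₀.1, τ₁, h₁.1, h₀.2, h₁.2, fun h => hne (h.eq_of_length hlen),
      fun h => hne (h.eq_of_length hlen.symm).symm⟩

namespace IsTower

variable {T : Set (List Bool)} {K : ℕ} {M : ℕ → List (List Bool)}

theorem downClosure_mono (h : IsTower T K M) : Monotone fun j => downClosure (M j) :=
  monotone_nat_of_le_succ fun j => (h j).2.downClosure_subset

/-- By `take_mem`, later levels add no node of length at most `level K j`. Membership is thus
settled at a finite stage. -/
theorem mem_towerTree_iff (h : IsTower T K M) {σ : List Bool} {j : ℕ}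
    (hσ : σ.length ≤ level K j) : σ ∈ towerTree M ↔ σ ∈ downClosure (M j) := by
  refine ⟨fun hmem => ?_, fun hmem => Set.mem_iUnion.2 ⟨j, hmem⟩⟩
  obtain ⟨i, hi⟩ := Set.mem_iUnion.1 hmem
  rcases le_total i j with hij | hij
  · exact h.downClosure_mono hij hi
  · induction i, hij using Nat.le_induction with
    | base => exact hi
    | succ i hij ih =>
      exact ih ((h i).2.mem_downClosure_of_le hi (hσ.trans (level_mono K hij)))

open Classical in
theorem extCount_towerTree (h : IsTower T K M) (j : ℕ) :
    extCount (towerTree M) [] (level K j) = (M j).length := by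
  rw [extCount, List.countP_eq_length_filter]
  refine List.Perm.length_eq
    ((List.perm_ext_iff_of_nodup ((nodup_strings _).filter _) (h j).1.nodup).2 fun σ => ?_)
  simp only [List.nil_append, List.mem_filter, mem_strings, decide_eq_true_eq]
  constructor
  · rintro ⟨hlen, hσ⟩
    rwa [h.mem_towerTree_iff hlen.le, mem_downClosure_iff (h j).1 hlen] at hσ
  · intro hσ
    exact ⟨(h j).1.length_eq σ hσ, Set.mem_iUnion.2 ⟨j, σ, hσ, List.prefix_rfl⟩⟩

theorem length_pos (h : IsTower T K M) (j : ℕ) : 0 < (M j).length :=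
  Nat.pos_of_mul_pos_left (lt_of_lt_of_le (by positivity) (h j).1.measure)

theorem isPositivePerfectSubtree (h : IsTower T K M) (hT : IsTree T) :
    IsPositivePerfectSubtree (towerTree M) T := by
  have htree : IsTree (towerTree M) := by
    intro σ τ hτ hσ
    obtain ⟨j, hj⟩ := Set.mem_iUnion.1 hσ
    exact Set.mem_iUnion.2 ⟨j, isTree_downClosure _ _ _ hτ hj⟩
  refine ⟨⟨htree, ?_, ?_⟩, ?_, ?_⟩
  · obtain ⟨σ, hσ⟩ := List.length_pos_iff_exists_mem.1 (h.length_pos 0)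
    exact ⟨σ, Set.mem_iUnion.2 ⟨0, σ, hσ, List.prefix_rfl⟩⟩
  · intro σ hσ
    obtain ⟨j, τ, hτ, hστ⟩ := Set.mem_iUnion.1 hσ
    obtain ⟨τ₀, h₀, τ₁, h₁, p₀, p₁, hinc⟩ := (h j).2.exists_split (h (j + 1)).1 hτ
    exact ⟨τ₀, Set.mem_iUnion.2 ⟨_, τ₀, h₀, List.prefix_rfl⟩,
      τ₁, Set.mem_iUnion.2 ⟨_, τ₁, h₁, List.prefix_rfl⟩, hστ.trans p₀, hστ.trans p₁, hinc⟩
  · refine isPositive_of_le htree (K := K) fun n => ⟨level K n, le_level K n, ?_⟩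
    rw [h.extCount_towerTree]
    exact (h n).1.measure
  · intro σ hσ
    obtain ⟨j, τ, hτ, hστ⟩ := Set.mem_iUnion.1 hσ
    exact hT _ _ hστ ((h j).1.mem τ hτ)

end IsTower

/-! ### Splitting levels with prescribed parities -/

/-- The nodes of the next splitting level before the parity is adjusted. -/
def candidates (bad : ℕ → List Bool → Bool) (K j : ℕ) (M : List (List Bool)) :
    List (List Bool) :=
  (M.flatMap fun σ => (strings (2 * j + K + 3)).map (σ ++ ·)).filter fun τ => !bad (K + j + 1) τ

/-- Splitting levels that avoid bad nodes, where the parity of the size of level `j + 1`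
is given by `a j`. -/
def codedLevel (bad : ℕ → List Bool → Bool) (a : ℕ → Bool) (K : ℕ) : ℕ → List (List Bool)
  | 0 => [[]]
  | j + 1 =>
    if ((candidates bad K j (codedLevel bad a K j)).length % 2 == 1) = a j then
      candidates bad K j (codedLevel bad a K j)
    else (candidates bad K j (codedLevel bad a K j)).tail

theorem length_of_mem_codedLevel {bad : ℕ → List Bool → Bool} {a : ℕ → Bool} {K j : ℕ}
    {σ : List Bool} (h : σ ∈ codedLevel bad a K j) : σ.length = level K j := by
  induction j generalizing σ with
  | zero => simp_all [codedLevel, level]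
  | succ j ih =>
    have hC : σ ∈ candidates bad K j (codedLevel bad a K j) := by
      rw [codedLevel] at h
      split_ifs at h
      exacts [h, List.mem_of_mem_tail h]
    simp only [candidates, List.mem_filter, List.mem_flatMap, List.mem_map, mem_strings] at hC
    obtain ⟨⟨τ, hτ, ρ, hρ, rfl⟩, -⟩ := hC
    rw [List.length_append, ih hτ, hρ, level_succ]

/-- The first levels depend only on a bounded part of the data. -/
theorem codedLevel_congr {bad bad' : ℕ → List Bool → Bool} {a a' : ℕ → Bool} {K n : ℕ}
    (hbad : ∀ j < n, ∀ τ : List Bool, τ.length = level K (j + 1) →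
      bad (K + j + 1) τ = bad' (K + j + 1) τ)
    (ha : ∀ j < n, a j = a' j) : codedLevel bad a K n = codedLevel bad' a' K n := by
  induction n with
  | zero => rfl
  | succ n ih =>
    have ih := ih (fun j hj => hbad j (by omega)) fun j hj => ha j (by omega)
    have hC : candidates bad K n (codedLevel bad a K n)
        = candidates bad' K n (codedLevel bad' a' K n) := by
      rw [ih]
      refine List.filter_congr fun τ hτ => ?_
      simp only [List.mem_flatMap, List.mem_map, mem_strings] at hτ
      obtain ⟨σ, hσ, ρ, hρ, rfl⟩ := hτ
      rw [hbad n n.lt_succ_self _ (by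
        rw [List.length_append, length_of_mem_codedLevel hσ, hρ, level_succ])]
    simp only [codedLevel, hC, ha n n.lt_succ_self]

/-- Each discarded element costs at most `c`; the bound charges `c` to every element. -/
theorem sum_map_le_filter {α : Type} (E : List α) (w : α → ℝ) (p : α → Bool) {c : ℝ}
    (hc : 0 ≤ c) (h : ∀ x ∈ E, p x = true → w x ≤ c) :
    (E.map w).sum ≤ ((E.filter fun x => !p x).map w).sum + E.length * c := by
  induction E with
  | nil => simp
  | cons x E ih =>
    have ih := ih fun y hy => h y (List.mem_cons_of_mem _ hy)
    have hx := h x List.mem_cons_self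
    rcases hp : p x
    · simp only [List.filter_cons, hp, List.map_cons, List.sum_cons, List.length_cons,
        Bool.not_false, if_true]
      push_cast
      linarith
    · simp only [List.filter_cons, hp, List.map_cons, List.sum_cons, List.length_cons,
        Bool.not_true, Bool.false_eq_true, if_false]
      push_cast
      linarith [hx hp]

theorem sum_map_le_length {α : Type} (E : List α) (w : α → ℝ) (h : ∀ x, w x ≤ 1) :
    (E.map w).sum ≤ E.length := by
  induction E with
  | nil => simp
  | cons x E ih =>
    simp only [List.map_cons, List.sum_cons, List.length_cons]
    push_cast
    linarith [h x]

-- Two estimates drive the proof: a global bound on the mass of a level gives the measure condition,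
-- and a local count above a single node gives splitting.
open Classical in
theorem exists_codedTower {T : Set (List Bool)} (hT : IsTree T) {K : ℕ}
    (hK : 3 / 2 ^ K ≤ weight T []) (a : ℕ → Bool) :
    IsTower T K (codedLevel (fun e τ => decide ((τ, e) ∈ thin T)) a K) := by
  set bad : ℕ → List Bool → Bool := fun e τ => decide ((τ, e) ∈ thin T) with hbad
  set L := codedLevel bad a K with hL
  have hbad_le : ∀ e τ, bad e τ = true → weight T τ ≤ 1 / 2 ^ e := fun e τ h =>
    weight_le_of_mem_thin (of_decide_eq_true h)
  have hbad_ge : ∀ e τ, bad e τ = false → 1 / 2 ^ e ≤ weight T τ := fun e τ h =>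
    le_weight_of_notMem_thin (of_decide_eq_false h)
  have hlen : ∀ j, ∀ σ ∈ L j, σ.length = level K j := fun j σ hσ => length_of_mem_codedLevel hσ
  have hsucc : ∀ j, (L (j + 1) = candidates bad K j (L j)) ∨
      L (j + 1) = (candidates bad K j (L j)).tail := fun j => by
    rw [hL, codedLevel]; split_ifs <;> simp
  have hsub : ∀ j, ∀ τ ∈ L (j + 1), τ ∈ candidates bad K j (L j) := fun j τ hτ => by
    rcases hsucc j with h | h <;> rw [h] at hτ
    exacts [hτ, List.mem_of_mem_tail hτ]
  -- The root is heavy by the choice of `K`, later nodes by the filter.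
  have hfat : ∀ j, ∀ σ ∈ L j, 1 / 2 ^ (K + j) ≤ weight T σ := by
    rintro (_ | j) σ hσ
    · have : σ = [] := by simpa [hL, codedLevel] using hσ
      rw [this]
      refine le_trans ?_ hK
      rw [add_zero]
      gcongr
      norm_num
    · have := hsub j σ hσ
      simp only [candidates, List.mem_filter, Bool.not_eq_true'] at this
      exact hbad_ge _ _ this.2
  have hnodupC : ∀ j, (L j).Nodup → (candidates bad K j (L j)).Nodup := by
    intro j hj
    refine List.Nodup.filter _ (List.nodup_flatMap.2 ⟨fun σ _ =>
      (nodup_strings _).map fun _ _ h => List.append_cancel_left h, ?_⟩)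
    refine hj.imp_of_mem fun {σ τ} hσ hτ hne => ?_
    simp only [Function.onFun, List.disjoint_left, List.mem_map, not_exists, not_and]
    rintro _ ⟨ρ, -, rfl⟩ ρ' - heq
    exact hne (List.append_inj heq ((hlen j τ hτ).trans (hlen j σ hσ).symm)).1.symm
  have hnodup : ∀ j, (L j).Nodup := by
    intro j
    induction j with
    | zero => simp [hL, codedLevel]
    | succ j ih =>
      rcases hsucc j with h | h <;> rw [h]
      exacts [hnodupC j ih, (hnodupC j ih).sublist (List.tail_sublist _)]
  have htail : ∀ j (p : List Bool → Bool),
      (candidates bad K j (L j)).countP p ≤ (L (j + 1)).countP p + 1 := by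
    intro j p
    rcases hsucc j with h | h <;> rw [h]
    · omega
    · cases candidates bad K j (L j) with
      | nil => simp
      | cons x C => simp only [List.countP_cons, List.tail_cons]; split_ifs <;> omega
  -- The factor `1 + 2 / 2 ^ j` starts at the `3` of `hK` and never falls below `1`. Passing to
  -- level `j + 1` it drops by `2 / 2 ^ (j + 1)`: half of this pays for the thin extensions, half
  -- for the node deleted to fix the parity.
  have hmass : ∀ j, 2 ^ level K j / 2 ^ K * (1 + 2 / 2 ^ j) ≤ ((L j).map (weight T)).sum := by
    intro j
    induction j with
    | zero =>
      simp only [hL, codedLevel, level, List.map_cons, List.map_nil, List.sum_cons, List.sum_nil]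
      norm_num
      rwa [div_eq_inv_mul] at hK
    | succ j ih =>
      set E := (L j).flatMap fun σ => (strings (2 * j + K + 3)).map (σ ++ ·) with hE
      have hEsum : (E.map (weight T)).sum = 2 ^ (2 * j + K + 3) * ((L j).map (weight T)).sum := by
        rw [hE]
        generalize L j = M
        induction M with
        | nil => simp
        | cons σ M ih =>
          rw [List.flatMap_cons, List.map_append, List.sum_append, ih, List.map_map,
            List.map_cons, List.sum_cons, mul_add, ← sum_weight_strings hT σ]
          rfl
      have hElen : E.length = (L j).length * 2 ^ (2 * j + K + 3) := by
        rw [hE]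
        simp [List.length_flatMap, length_strings]
      have hLlen : (L j).length ≤ 2 ^ level K j := by
        rw [← length_strings]
        refine (List.subperm_of_subset (hnodup j) fun σ hσ => ?_).length_le
        exact mem_strings.2 (hlen j σ hσ)
      have hElen' : (E.length : ℝ) ≤ 2 ^ level K (j + 1) := by
        rw [hElen, level_succ, pow_add _ (level K j)]
        push_cast
        gcongr
        exact_mod_cast hLlen
      have h₁ := sum_map_le_filter E (weight T) (bad (K + j + 1)) (c := 1 / 2 ^ (K + j + 1))
        (by positivity) fun x _ hx => hbad_le _ _ hx
      have h₂ : ((candidates bad K j (L j)).map (weight T)).sum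
          ≤ ((L (j + 1)).map (weight T)).sum + 1 := by
        rcases hsucc j with h | h <;> rw [h]
        · linarith
        · cases candidates bad K j (L j) with
          | nil => simp
          | cons x C =>
            simp only [List.map_cons, List.sum_cons, List.tail_cons]
            linarith [weight_le_one T x]
      change (E.map (weight T)).sum ≤ ((candidates bad K j (L j)).map (weight T)).sum + _ at h₁
      rw [hEsum] at h₁
      have h₃ : (E.length : ℝ) * (1 / 2 ^ (K + j + 1))
          ≤ 2 ^ level K (j + 1) * (1 / 2 ^ (K + j + 1)) := by gcongr
      have h₄ : (2 : ℝ) ^ (2 * j + K + 3) * (2 ^ level K j / 2 ^ K * (1 + 2 / 2 ^ j))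
          ≤ 2 ^ (2 * j + K + 3) * ((L j).map (weight T)).sum := by gcongr
      have h₅ : (2 : ℝ) ^ (2 * j + K + 3) * (2 ^ level K j / 2 ^ K * (1 + 2 / 2 ^ j))
          = 2 ^ level K (j + 1) / 2 ^ K * (1 + 2 / 2 ^ j) := by
        rw [level_succ, pow_add _ (level K j)]; ring
      -- The deleted node has weight at most `1`, which its share covers because `K + (j + 1) ≤
      -- level K (j + 1)`.
      have h₆ : (1 : ℝ) ≤ 2 ^ level K (j + 1) / 2 ^ K * (1 / 2 ^ (j + 1)) := by
        rw [div_mul_div_comm, mul_one, ← pow_add, one_le_div (by positivity)]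
        refine pow_le_pow_right₀ (by norm_num) ?_
        unfold level
        nlinarith
      have h₇ : (2 : ℝ) ^ level K (j + 1) * (1 / 2 ^ (K + j + 1))
          = 2 ^ level K (j + 1) / 2 ^ K * (1 / 2 ^ (j + 1)) := by
        rw [add_assoc, pow_add]; field_simp
      have h₈ : (2 : ℝ) / 2 ^ j = 2 * (2 / 2 ^ (j + 1)) := by
        rw [pow_succ]; field_simp
      rw [h₈] at h₄ h₅
      have h₉ : (1 : ℝ) / 2 ^ (j + 1) = 2 / 2 ^ (j + 1) / 2 := by ring
      rw [h₉] at h₆ h₇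
      rw [h₇] at h₃
      rw [h₅] at h₄
      nlinarith
  refine fun j => ⟨⟨hnodup j, hlen j, fun σ hσ => ?_, ?_⟩, ⟨fun τ hτ => ?_, fun σ hσ => ?_⟩⟩
  · exact mem_of_weight_pos (lt_of_lt_of_le (by positivity) (hfat j σ hσ))
  -- Weights are at most `1`, so the mass bounds the number of nodes from below.
  · have h₁ := (hmass j).trans (sum_map_le_length (L j) _ (weight_le_one T))
    have h₂ : (2 : ℝ) ^ level K j / 2 ^ K ≤ (L j).length := by
      refine le_trans (le_mul_of_one_le_right (by positivity) ?_) h₁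
      have : (0 : ℝ) ≤ 2 / 2 ^ j := by positivity
      linarith
    rw [div_le_iff₀ (by positivity), mul_comm] at h₂
    exact_mod_cast h₂
  · have := hsub j τ hτ
    simp only [candidates, List.mem_filter, List.mem_flatMap, List.mem_map] at this
    obtain ⟨⟨σ, hσ, ρ, -, rfl⟩, -⟩ := this
    rwa [List.take_left' (hlen j σ hσ)]
  -- The extensions of `σ` have total weight at least `2 ^ (j + 3)`, and the bad ones account for at
  -- most `2 ^ (j + 2)`. At least four good ones remain, hence three after a deletion.
  · set D := ((strings (2 * j + K + 3)).map (σ ++ ·)).filter fun τ => !bad (K + j + 1) τ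
    have hDC : D.length ≤ (candidates bad K j (L j)).countP fun τ => decide (σ <+: τ) := by
      rw [List.countP_eq_length_filter]
      refine (List.subperm_of_subset (((nodup_strings _).map
        fun _ _ h => List.append_cancel_left h).filter _) fun τ hτ => ?_).length_le
      simp only [List.mem_filter, List.mem_map] at hτ
      obtain ⟨⟨ρ, hρ, rfl⟩, hb⟩ := hτ
      simp only [candidates, List.mem_filter, List.mem_flatMap, List.mem_map]
      exact ⟨⟨⟨σ, hσ, ρ, hρ, rfl⟩, hb⟩, decide_eq_true (List.prefix_append _ _)⟩
    have h₁ := sum_map_le_filter ((strings (2 * j + K + 3)).map (σ ++ ·)) (weight T)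
      (bad (K + j + 1)) (c := 1 / 2 ^ (K + j + 1)) (by positivity) fun x _ hx => hbad_le _ _ hx
    rw [List.map_map, List.length_map, length_strings] at h₁
    have h₂ := sum_weight_strings hT σ (2 * j + K + 3)
    have h₃ := sum_map_le_length D _ (weight_le_one T)
    have h₄ : (2 : ℝ) ^ (2 * j + K + 3) * (1 / 2 ^ (K + j))
        ≤ 2 ^ (2 * j + K + 3) * weight T σ := by
      gcongr
      exact hfat j σ hσ
    have h₅ : (2 : ℝ) ^ (2 * j + K + 3) * (1 / 2 ^ (K + j)) = 2 * 2 ^ (j + 2) := by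
      rw [show 2 * j + K + 3 = (K + j) + (1 + (j + 2)) by ring, pow_add, pow_add 2 1]; field_simp
    have h₆ : (2 : ℝ) ^ (2 * j + K + 3) * (1 / 2 ^ (K + j + 1)) = 2 ^ (j + 2) := by
      rw [show 2 * j + K + 3 = (K + j + 1) + (j + 2) by ring, pow_add]; field_simp
    have h₇ : (2 : ℝ) ^ (j + 2) ≤ D.length := by
      change _ = _ at h₂
      simp only [Function.comp_def] at h₁
      push_cast at h₁
      linarith
    have h₈ : 2 ^ (j + 2) ≤ D.length := by exact_mod_cast h₇
    have h₉ : 4 ≤ 2 ^ (j + 2) := by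
      rw [pow_add]; have := Nat.one_le_two_pow (n := j); omega
    have := htail j fun τ => decide (σ <+: τ)
    omega

/-- Deleting a node flips the parity. Nonemptiness matters: the tail of an empty list is empty and
flips nothing. -/
theorem codedLevel_parity {bad : ℕ → List Bool → Bool} {a : ℕ → Bool} {K j : ℕ}
    (h : 0 < (codedLevel bad a K (j + 1)).length) :
    (codedLevel bad a K (j + 1)).length % 2 = 1 ↔ a j = true := by
  rw [codedLevel] at h ⊢
  split_ifs at h ⊢ with hC
  · rw [← hC, beq_iff_eq]
  · rw [List.length_tail] at h ⊢
    rcases ha : a j <;> rw [ha] at hC <;> simp at hC <;> simp <;> omega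

end PerfTree

/-! ### Primitive recursive operations on lists -/

section Primrec

variable {α β : Type} [Primcodable α] [Primcodable β]

theorem PrimrecPred.ball {f : α → List β} {p : α → β → Prop} (hf : Primrec f)
    (hp : PrimrecRel p) : PrimrecPred fun a => ∀ b ∈ f a, p a b :=
  hp.swap.forall_mem_list.comp hf Primrec.id

theorem PrimrecPred.bex {f : α → List β} {p : α → β → Prop} (hf : Primrec f)
    (hp : PrimrecRel p) : PrimrecPred fun a => ∃ b ∈ f a, p a b :=
  hp.swap.exists_mem_list.comp hf Primrec.id

theorem PrimrecPred.imp {p q : α → Prop} (hp : PrimrecPred p) (hq : PrimrecPred q) :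
    PrimrecPred fun a => p a → q a :=
  (hp.not.or hq).of_eq fun _ => imp_iff_not_or.symm

theorem Primrec.list_filter {f : α → List β} {p : α → β → Bool} (hf : Primrec f)
    (hp : Primrec₂ p) : Primrec fun a => (f a).filter (p a) := by
  refine (Primrec.listFilterMap hf (g := fun a b => bif p a b then some b else none)
    (Primrec.cond hp (Primrec.option_some.comp Primrec.snd) (Primrec.const none)).to₂).of_eq
    fun a => ?_
  rw [← List.filterMap_eq_filter]
  congr 1
  funext b
  cases h : p a b <;> simp [Option.guard, h]

theorem Primrec.list_countP {f : α → List β} {p : α → β → Bool} (hf : Primrec f)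
    (hp : Primrec₂ p) : Primrec fun a => (f a).countP (p a) :=
  (Primrec.list_length.comp (Primrec.list_filter hf hp)).of_eq fun _ =>
    List.countP_eq_length_filter.symm

theorem Primrec.list_sum : Primrec (List.sum : List ℕ → ℕ) :=
  (Primrec.list_foldr Primrec.id (Primrec.const 0)
    (Primrec.nat_add.comp (Primrec.fst.comp Primrec.snd) (Primrec.snd.comp Primrec.snd)).to₂).of_eq
    fun _ => rfl

theorem Primrec.nat_pow : Primrec₂ ((· ^ ·) : ℕ → ℕ → ℕ) :=
  Primrec₂.unpaired'.1 Nat.Primrec.pow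

theorem Primrec.nat_testBit : Primrec₂ Nat.testBit :=
  ((Primrec.eq.comp (Primrec.nat_mod.comp (Primrec.nat_div.comp Primrec.fst
    (Primrec.nat_pow.comp (Primrec.const 2) Primrec.snd)) (Primrec.const 2))
    (Primrec.const 1)).decide).of_eq fun _ => (Nat.testBit_eq_decide_div_mod_eq).symm

theorem primrecRel_isPrefix [DecidableEq α] : PrimrecRel fun σ τ : List α => σ <+: τ :=
  (Primrec.eq.comp Primrec.fst (Primrec.list_take.comp (Primrec.list_length.comp Primrec.fst)
    Primrec.snd)).of_eq fun _ => List.prefix_iff_eq_take.symm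

end Primrec

/-- A crude primitive recursive bound on a finite set of oracle queries: the sum of the queried
codes, plus one. -/
theorem List.lt_sum_add_one_of_mem {l : List ℕ} {n : ℕ} (h : n ∈ l) : n < l.sum + 1 :=
  Nat.lt_succ_of_le (List.le_sum_of_mem h)

namespace PerfTree

theorem primrec_strings : Primrec strings := by
  have hcons : ∀ b : Bool, Primrec₂ fun (_ : ℕ × List (List Bool)) (σ : List Bool) => b :: σ :=
    fun b => Primrec.list_cons.comp (Primrec.const b) Primrec.snd
  have : Primrec (Nat.rec [[]] fun _ M => M.map (false :: ·) ++ M.map (true :: ·) :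
      ℕ → List (List Bool)) :=
    Primrec.nat_rec₁ _ (Primrec.list_append.comp (Primrec.list_map Primrec.snd (hcons false))
      (Primrec.list_map Primrec.snd (hcons true)))
  refine this.of_eq fun n => ?_
  induction n with
  | zero => rfl
  | succ n ih => simp only [strings, ← ih]

theorem primrec_level (K : ℕ) : Primrec (level K) :=
  Primrec.nat_mul.comp Primrec.id
    (Primrec.nat_add.comp (Primrec.nat_add.comp Primrec.id (Primrec.const K)) (Primrec.const 2))

theorem primrec_oracle_getD {α : Type} [Primcodable α] {β : Type} [Primcodable β]
    {f : β → List Bool} {g : β → α} (hf : Primrec f) (hg : Primrec g) :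
    Primrec fun b => (f b).getD (Encodable.encode (g b)) false :=
  (Primrec.list_getD false).comp hf (Primrec.encode.comp hg)

theorem encode_mem_codes {α : Type} [Encodable α] {S : Set α} {a : α} :
    Encodable.encode a ∈ codes S ↔ a ∈ S :=
  Encodable.encode_injective.mem_set_image

/-- A reduction given by a primitive recursive relation. -/
theorem SetReducible.of_segment_rel {α : Type} [Primcodable α] {S : Set α} {A C : Set ℕ}
    {u : α → ℕ} {R : α → List Bool → Prop} (hA : SetReducible A C) (hu : Primrec u)
    (hR : PrimrecRel R) (h : ∀ a, a ∈ S ↔ R a (PerfTree.segment A (u a))) :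
    SetReducible (codes S) C := by
  classical
  exact .of_segment hA hu hR.decide fun a => by rw [h, decide_eq_true_iff]

/-! ### Thin nodes -/

/-- For a given `n` the inequality is decided by finitely many queries to `T`; the jump absorbs the
quantifier over `n`. -/
theorem setReducible_thin (T : Set (List Bool)) :
    SetReducible (codes (thin T)) (jump (codes T)) := by
  classical
  let Q : Set ((List Bool × ℕ) × ℕ) := {x | 2 ^ x.1.2 * extCount T x.1.1 x.2 < 2 ^ x.2}
  have hstr : Primrec fun x : (List Bool × ℕ) × ℕ => strings x.2 :=
    primrec_strings.comp Primrec.snd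
  have hu : Primrec fun x : (List Bool × ℕ) × ℕ =>
      ((strings x.2).map fun ρ => Encodable.encode (x.1.1 ++ ρ)).sum + 1 :=
    Primrec.succ.comp (Primrec.list_sum.comp (Primrec.list_map hstr (Primrec.encode.comp
      (Primrec.list_append.comp (Primrec.fst.comp (Primrec.fst.comp Primrec.fst)) Primrec.snd))))
  have hR : PrimrecRel fun (x : (List Bool × ℕ) × ℕ) (l : List Bool) =>
      2 ^ x.1.2 * (strings x.2).countP (fun ρ => l.getD (Encodable.encode (x.1.1 ++ ρ)) false)
        < 2 ^ x.2 := by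
    refine Primrec.nat_lt.comp (Primrec.nat_mul.comp (Primrec.nat_pow.comp (Primrec.const 2)
      (Primrec.snd.comp (Primrec.fst.comp Primrec.fst)))
      (Primrec.list_countP (hstr.comp Primrec.fst) ?_))
      (Primrec.nat_pow.comp (Primrec.const 2) (Primrec.snd.comp Primrec.fst))
    exact primrec_oracle_getD (Primrec.snd.comp Primrec.fst) (Primrec.list_append.comp
      (Primrec.fst.comp (Primrec.fst.comp (Primrec.fst.comp Primrec.fst))) Primrec.snd)
  have hQ : SetReducible (codes Q) (codes T) := by
    refine .of_segment_rel (.refl _) hu hR fun x => ?_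
    have : extCount T x.1.1 x.2 = (strings x.2).countP (fun ρ => (segment (codes T)
        (((strings x.2).map fun ρ => Encodable.encode (x.1.1 ++ ρ)).sum + 1)).getD
        (Encodable.encode (x.1.1 ++ ρ)) false) := by
      refine List.countP_congr fun ρ hρ => ?_
      rw [segment_getD _ (List.lt_sum_add_one_of_mem (List.mem_map_of_mem hρ)), encode_mem_codes,
        decide_eq_true_iff]
    rw [← this]
    rfl
  convert hQ.exists_pair_jump using 1
  ext m
  constructor
  · rintro ⟨x, ⟨n, hn⟩, rfl⟩
    exact ⟨n, (x, n), hn, rfl⟩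
  · rintro ⟨n, ⟨x, n'⟩, hx, heq⟩
    obtain ⟨rfl, -⟩ := Nat.pair_eq_pair.1 heq
    exact ⟨x, ⟨n', hx⟩, rfl⟩

/-! ### Coding a set into a subtree -/

/-- Finite lists of answers stand in for the thinness oracle and for the coded set; the default
`false` is irrelevant once the lists are long enough. -/
theorem primrec_codedLevel (K : ℕ) :
    Primrec₂ fun (p : List Bool × List Bool) (n : ℕ) =>
      codedLevel (fun e τ => p.1.getD (Encodable.encode (τ, e)) false)
        (fun j => p.2.getD j false) K n := by
  have hC : Primrec₂ fun (p : List Bool × List Bool) (x : ℕ × List (List Bool)) =>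
      candidates (fun e τ => p.1.getD (Encodable.encode (τ, e)) false) K x.1 x.2 := by
    refine Primrec.list_filter (Primrec.list_flatMap (Primrec.snd.comp Primrec.snd)
      (Primrec.list_map (primrec_strings.comp ?_) ?_)) ?_
    · exact Primrec.nat_add.comp (Primrec.nat_add.comp (Primrec.nat_mul.comp (Primrec.const 2)
        (Primrec.fst.comp (Primrec.snd.comp Primrec.fst))) (Primrec.const K)) (Primrec.const 3)
    · exact Primrec.list_append.comp (Primrec.snd.comp Primrec.fst) Primrec.snd
    · exact Primrec.not.comp (primrec_oracle_getD (Primrec.fst.comp (Primrec.fst.comp Primrec.fst))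
        (Primrec.pair Primrec.snd (Primrec.succ.comp (Primrec.nat_add.comp (Primrec.const K)
          (Primrec.fst.comp (Primrec.snd.comp Primrec.fst))))))
  have hstep : Primrec₂ fun (p : List Bool × List Bool) (x : ℕ × List (List Bool)) =>
      if ((candidates (fun e τ => p.1.getD (Encodable.encode (τ, e)) false) K x.1 x.2).length % 2
        == 1) = p.2.getD x.1 false then
        candidates (fun e τ => p.1.getD (Encodable.encode (τ, e)) false) K x.1 x.2
      else (candidates (fun e τ => p.1.getD (Encodable.encode (τ, e)) false) K x.1 x.2).tail :=
    Primrec.ite (Primrec.eq.comp (Primrec.beq.comp (Primrec.nat_mod.comp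
      (Primrec.list_length.comp hC) (Primrec.const 2)) (Primrec.const 1))
      ((Primrec.list_getD false).comp (Primrec.snd.comp Primrec.fst)
        (Primrec.fst.comp Primrec.snd))) hC (Primrec.list_tail.comp hC)
  refine (Primrec.nat_rec (Primrec.const [[]]) hstep).of_eq fun p n => ?_
  induction n with
  | zero => rfl
  | succ n ih => simp only [codedLevel, ← ih]

-- Since `σ.length ≤ level K σ.length`, the level with index `σ.length` decides whether `σ` is in
-- the tree.
open Classical in
theorem setReducible_codedTree {T : Set (List Bool)} {K : ℕ} {A : Set ℕ}
    (hA : SetReducible (jump (codes T)) A)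
    (hM : IsTower T K (codedLevel (fun e τ => decide ((τ, e) ∈ thin T))
      (fun j => decide (j ∈ A)) K)) :
    SetReducible (codes (towerTree (codedLevel (fun e τ => decide ((τ, e) ∈ thin T))
      (fun j => decide (j ∈ A)) K))) A := by
  -- The sum covers the thinness queries for all levels up to that index; the last summand covers
  -- the digits of `A`.
  have hu : Primrec fun σ : List Bool =>
      ((List.range σ.length).flatMap fun j => (strings (level K (j + 1))).map
        fun τ => Encodable.encode (τ, K + j + 1)).sum + 1 + σ.length := by
    refine Primrec.nat_add.comp (Primrec.succ.comp (Primrec.list_sum.comp (Primrec.list_flatMap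
      (Primrec.list_range.comp Primrec.list_length) (Primrec.list_map (primrec_strings.comp
        ((primrec_level K).comp (Primrec.succ.comp Primrec.snd))) ?_)))) Primrec.list_length
    exact Primrec.encode.comp (Primrec.pair Primrec.snd (Primrec.succ.comp (Primrec.nat_add.comp
      (Primrec.const K) (Primrec.snd.comp Primrec.fst))))
  have hR : PrimrecRel fun (σ : List Bool) (p : List Bool × List Bool) =>
      ∃ τ ∈ codedLevel (fun e τ => p.1.getD (Encodable.encode (τ, e)) false)
        (fun j => p.2.getD j false) K σ.length, σ <+: τ :=
    PrimrecPred.bex ((primrec_codedLevel K).comp Primrec.snd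
      (Primrec.list_length.comp Primrec.fst))
      (primrecRel_isPrefix.comp (Primrec.fst.comp Primrec.fst) Primrec.snd)
  refine .of_segments ((setReducible_thin T).trans hA) (.refl A) hu hR.decide fun σ => ?_
  rw [decide_eq_true_iff, hM.mem_towerTree_iff (le_level K σ.length),
    codedLevel_congr (n := σ.length)]
  · rfl
  · intro j hj τ hτ
    rw [Bool.eq_iff_iff, decide_eq_true_iff, segment_getD, encode_mem_codes]
    refine lt_of_lt_of_le (List.lt_sum_add_one_of_mem ?_) (Nat.le_add_right _ _)
    exact List.mem_flatMap.2 ⟨j, List.mem_range.2 hj,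
      List.mem_map.2 ⟨τ, mem_strings.2 hτ, rfl⟩⟩
  · intro j hj
    rw [Bool.eq_iff_iff, decide_eq_true_iff, segment_getD _ (by omega)]

open Classical in
theorem setReducible_of_parity {P : Set (List Bool)} {K : ℕ} {A : Set ℕ}
    (h : ∀ j, extCount P [] (level K (j + 1)) % 2 = 1 ↔ j ∈ A) :
    SetReducible A (codes P) := by
  have hstr : Primrec fun j : ℕ => strings (level K (j + 1)) :=
    primrec_strings.comp ((primrec_level K).comp Primrec.succ)
  have hu : Primrec fun j : ℕ => ((strings (level K (j + 1))).map Encodable.encode).sum + 1 :=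
    Primrec.succ.comp (Primrec.list_sum.comp (Primrec.list_map hstr
      (Primrec.encode.comp Primrec.snd)))
  have hR : PrimrecRel fun (j : ℕ) (l : List Bool) => (strings (level K (j + 1))).countP
      (fun σ => l.getD (Encodable.encode σ) false) % 2 = 1 :=
    Primrec.eq.comp (Primrec.nat_mod.comp (Primrec.list_countP (hstr.comp Primrec.fst)
      (primrec_oracle_getD (Primrec.snd.comp Primrec.fst) Primrec.snd)) (Primrec.const 2))
      (Primrec.const 1)
  rw [← codes_nat A]
  refine .of_segment_rel (.refl _) hu hR fun j => ?_
  rw [← h, extCount]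
  have : (strings (level K (j + 1))).countP (fun ρ => decide ([] ++ ρ ∈ P))
      = (strings (level K (j + 1))).countP (fun σ => (segment (codes P)
        (((strings (level K (j + 1))).map Encodable.encode).sum + 1)).getD
        (Encodable.encode σ) false) := by
    refine List.countP_congr fun σ hσ => ?_
    rw [segment_getD _ (List.lt_sum_add_one_of_mem (List.mem_map_of_mem hσ)), encode_mem_codes,
      decide_eq_true_iff, List.nil_append]
  rw [this]

theorem exists_weight_bound {T : Set (List Bool)} (hpos : IsPositive T) :
    ∃ K : ℕ, 3 / 2 ^ K ≤ weight T [] := by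
  obtain ⟨K, hK⟩ := exists_pow_lt_of_lt_one (div_pos (weight_nil_pos hpos) (by norm_num : (0 : ℝ) < 3))
    (by norm_num : (1 / 2 : ℝ) < 1)
  refine ⟨K, ?_⟩
  rw [lt_div_iff₀ (by norm_num), one_div, inv_pow] at hK
  rw [div_eq_inv_mul]
  exact hK.le

theorem exists_positivePerfectSubtree_equivalent {T : Set (List Bool)} (hT : IsTree T)
    (hpos : IsPositive T) {A : Set ℕ} (hA : SetReducible (jump (codes T)) A) :
    ∃ P : Set (List Bool), IsPositivePerfectSubtree P T ∧
      SetEquivalent A (join (codes T) (codes P)) := by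
  classical
  obtain ⟨K, hK⟩ := exists_weight_bound hpos
  have hM := exists_codedTower hT hK fun j => decide (j ∈ A)
  refine ⟨_, hM.isPositivePerfectSubtree hT, ?_, ?_⟩
  -- `A` is recovered from the subtree alone.
  · refine SetReducible.trans (setReducible_of_parity (K := K) fun j => ?_) (.join_right _ _)
    rw [hM.extCount_towerTree, codedLevel_parity (hM.length_pos _), decide_eq_true_iff]
  · exact SetReducible.join ((SetReducible.jump_self _).trans hA) (setReducible_codedTree hA hM)

end PerfTree

namespace PerfTree

/-! ### The tree of finite approximations -/

/-- The initial segments of the members of a list of strings, as a list. -/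
def prefixes (M : List (List Bool)) : List (List Bool) :=
  M.flatMap fun τ => (List.range (τ.length + 1)).map fun n => τ.take n

theorem mem_prefixes {M : List (List Bool)} {σ : List Bool} :
    σ ∈ prefixes M ↔ σ ∈ downClosure M := by
  simp only [prefixes, List.mem_flatMap, List.mem_map, List.mem_range, downClosure,
    Set.mem_ofPred_eq]
  refine exists_congr fun τ => and_congr_right fun _ => ⟨?_, fun h => ?_⟩
  · rintro ⟨n, -, rfl⟩
    exact List.take_prefix _ _
  · exact ⟨σ.length, Nat.lt_succ_of_le h.length_le, (List.prefix_iff_eq_take.1 h).symm⟩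

/-- The members of `finSet k` on the `j`-th splitting level. -/
def topLevel (K j k : ℕ) : List (List Bool) :=
  (strings (level K j)).filter fun σ => k.testBit (Encodable.encode σ)

theorem mem_topLevel {K j k : ℕ} {σ : List Bool} :
    σ ∈ topLevel K j k ↔ σ.length = level K j ∧ σ ∈ finSet k := by
  simp [topLevel, mem_strings, finSet]

/-- The binary digits of `k` that are `1` are exactly those at the codes of the initial
segments of members of `M`. -/
def IsCodeOf (k : ℕ) (M : List (List Bool)) : Prop :=
  (∀ σ ∈ prefixes M, k.testBit (Encodable.encode σ) = true) ∧
    ∀ n ∈ List.range k, k.testBit n = true → ∃ σ ∈ prefixes M, Encodable.encode σ = n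

/-- Shows that the bounded quantifier in `IsCodeOf`, needed for primitive recursiveness, misses no
digit. -/
theorem lt_of_testBit {k n : ℕ} (h : k.testBit n = true) : n < k :=
  lt_of_lt_of_le Nat.lt_two_pow_self (Nat.ge_two_pow_of_testBit h)

theorem IsCodeOf.finSet_eq {k : ℕ} {M : List (List Bool)} (h : IsCodeOf k M) :
    finSet k = downClosure M := by
  ext σ
  rw [← mem_prefixes]
  refine ⟨fun hσ => ?_, fun hσ => h.1 σ hσ⟩
  obtain ⟨τ, hτ, heq⟩ := h.2 _ (List.mem_range.2 (lt_of_testBit hσ)) hσ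
  rwa [← Encodable.encode_injective heq]

theorem exists_testBit_iff (l : List ℕ) : ∃ k : ℕ, ∀ n, k.testBit n = true ↔ n ∈ l := by
  induction l with
  | nil => exact ⟨0, by simp⟩
  | cons a l ih =>
    obtain ⟨k, hk⟩ := ih
    refine ⟨2 ^ a ||| k, fun n => ?_⟩
    simp [Nat.testBit_two_pow, hk, eq_comm (a := a)]

theorem exists_isCodeOf (M : List (List Bool)) : ∃ k, IsCodeOf k M := by
  obtain ⟨k, hk⟩ := exists_testBit_iff ((prefixes M).map Encodable.encode)
  exact ⟨k, fun σ hσ => (hk _).2 (List.mem_map_of_mem hσ), fun n _ hn => by simpa using (hk n).1 hn⟩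

/-- A code determines a level only up to order, so the tower conditions are transported along
permutations. -/
theorem IsCodeOf.of_perm {k : ℕ} {M N : List (List Bool)} (h : IsCodeOf k M) (hp : M.Perm N) :
    IsCodeOf k N := by
  have : ∀ σ, σ ∈ prefixes N ↔ σ ∈ prefixes M := fun σ => by
    simp only [mem_prefixes, downClosure, Set.mem_ofPred_eq, hp.mem_iff]
  simpa only [IsCodeOf, this] using h

theorem IsTowerLevel.of_perm {T : Set (List Bool)} {K j : ℕ} {M N : List (List Bool)}
    (h : IsTowerLevel T K j M) (hp : M.Perm N) : IsTowerLevel T K j N :=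
  ⟨hp.nodup_iff.1 h.nodup, fun σ hσ => h.length_eq σ (hp.mem_iff.2 hσ),
    fun σ hσ => h.mem σ (hp.mem_iff.2 hσ), hp.length_eq ▸ h.measure⟩

theorem IsTowerStep.of_perm {K j : ℕ} {M M' N N' : List (List Bool)}
    (h : IsTowerStep K j M N) (hM : M.Perm M') (hN : N.Perm N') : IsTowerStep K j M' N' :=
  ⟨fun τ hτ => hM.mem_iff.1 (h.take_mem τ (hN.mem_iff.2 hτ)),
    fun σ hσ => (h.split σ (hM.mem_iff.2 hσ)).trans_eq (hN.countP_eq _)⟩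

theorem perm_topLevel {T : Set (List Bool)} {K j k : ℕ} {M : List (List Bool)}
    (hM : IsTowerLevel T K j M) (hk : IsCodeOf k M) : M.Perm (topLevel K j k) := by
  refine (List.perm_ext_iff_of_nodup hM.nodup ((nodup_strings _).filter _)).2 fun σ => ?_
  change σ ∈ M ↔ σ ∈ topLevel K j k
  rw [mem_topLevel, hk.finSet_eq]
  exact ⟨fun h => ⟨hM.length_eq σ h, σ, h, List.prefix_rfl⟩,
    fun ⟨h₁, h₂⟩ => (mem_downClosure_iff hM h₁).1 h₂⟩

theorem isTowerLevel_topLevel_iff {T : Set (List Bool)} {K j k : ℕ} :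
    IsTowerLevel T K j (topLevel K j k) ↔
      (∀ σ ∈ topLevel K j k, σ ∈ T) ∧ 2 ^ level K j ≤ 2 ^ K * (topLevel K j k).length :=
  ⟨fun h => ⟨h.mem, h.measure⟩, fun h => ⟨(nodup_strings _).filter _,
    fun _ hσ => (mem_topLevel.1 hσ).1, h.1, h.2⟩⟩

theorem isTowerStep_iff {K j : ℕ} {M N : List (List Bool)} :
    IsTowerStep K j M N ↔ (∀ τ ∈ N, τ.take (level K j) ∈ M) ∧
      ∀ σ ∈ M, 2 ≤ N.countP fun τ => decide (σ <+: τ) :=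
  ⟨fun h => ⟨h.1, h.2⟩, fun h => ⟨h.1, h.2⟩⟩

/-- Finite sequences of codes of finite trees that satisfy the requirements on towers. -/
def approximations (T : Set (List Bool)) (K : ℕ) : Set (List ℕ) :=
  {s | ∀ i ∈ List.range s.length, IsTowerLevel T K i (topLevel K i (s.getD i 0)) ∧
    IsCodeOf (s.getD i 0) (topLevel K i (s.getD i 0)) ∧
    (i + 1 < s.length → IsTowerStep K i (topLevel K i (s.getD i 0))
      (topLevel K (i + 1) (s.getD (i + 1) 0)))}

theorem isTree_approximations (T : Set (List Bool)) (K : ℕ) : IsTree (approximations T K) := by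
  rintro _ t ⟨r, rfl⟩ hs i hi
  have hi' := List.mem_range.1 hi
  obtain ⟨h₁, h₂, h₃⟩ := hs i (List.mem_range.2 (by rw [List.length_append]; omega))
  rw [List.getD_append _ _ _ _ hi'] at h₁ h₂ h₃
  refine ⟨h₁, h₂, fun h => ?_⟩
  rw [List.getD_append _ _ _ _ h] at h₃
  exact h₃ (by rw [List.length_append]; omega)

theorem isTreeOfFiniteSubtrees_approximations {T : Set (List Bool)} (hT : IsTree T) (K : ℕ) :
    IsTreeOfFiniteSubtrees (approximations T K) T := by
  refine ⟨isTree_approximations T K, fun s hs => ⟨fun k hk => ?_, ?_⟩⟩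
  · obtain ⟨i, hi, rfl⟩ := List.getElem_of_mem hk
    obtain ⟨h₁, h₂, -⟩ := hs i (List.mem_range.2 hi)
    rw [List.getD_eq_getElem _ _ hi] at h₁ h₂
    rw [h₂.finSet_eq]
    exact ⟨isTree_downClosure _, fun σ ⟨τ, hτ, hσ⟩ => hT _ _ hσ (h₁.mem τ hτ)⟩
  · rw [List.isChain_iff_getElem]
    intro i hi
    obtain ⟨h₁, h₂, h₃⟩ := hs i (List.mem_range.2 (by omega))
    obtain ⟨-, h₄, -⟩ := hs (i + 1) (List.mem_range.2 hi)
    have h₃ := h₃ hi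
    rw [List.getD_eq_getElem _ _ (by omega : i < s.length)] at h₁ h₂ h₃
    rw [List.getD_eq_getElem _ _ hi] at h₃ h₄
    rw [h₂.finSet_eq, h₄.finSet_eq]
    refine ⟨isTree_downClosure _, isTree_downClosure _, h₃.downClosure_subset, fun σ hσ => ?_⟩
    -- All maximal nodes of the earlier tree have length `level K i`; a longer `σ` extends the leaf
    -- obtained by truncating a top node above it.
    rcases le_total σ.length (level K i) with hle | hle
    · exact .inl (h₃.mem_downClosure_of_le hσ hle)
    · obtain ⟨ρ, hρ, hσρ⟩ := hσ
      have hmem := h₃.take_mem ρ hρ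
      refine .inr ⟨ρ.take (level K i), ⟨⟨_, hmem, List.prefix_rfl⟩, ?_⟩, ?_⟩
      · rintro τ ⟨υ, hυ, hτ⟩ hpre
        refine (hpre.eq_of_length_le ?_).symm
        rw [h₁.length_eq _ hmem, ← h₁.length_eq υ hυ]
        exact hτ.length_le
      · exact List.prefix_of_prefix_length_le (List.take_prefix _ _) hσρ
          ((List.length_take_le _ _).trans hle)

theorem isPositivePerfectSubtree_pathUnion {T : Set (List Bool)} (hT : IsTree T) {K : ℕ}
    {X : ℕ → ℕ} (hX : X ∈ paths (approximations T K)) :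
    IsPositivePerfectSubtree (pathUnion X) T := by
  have hget : ∀ {n i : ℕ}, i < n → ((List.range n).map X).getD i 0 = X i := fun h => by
    simp [List.getD, h]
  have key : ∀ j, IsTowerLevel T K j (topLevel K j (X j)) ∧
      IsCodeOf (X j) (topLevel K j (X j)) ∧
      IsTowerStep K j (topLevel K j (X j)) (topLevel K (j + 1) (X (j + 1))) := fun j => by
    -- Length `j + 2` is the least at which the step from level `j` to level `j + 1` is imposed.
    have h := hX (j + 2) j (List.mem_range.2 (by simp))
    rw [hget (by omega : j < j + 2), hget (by omega : j + 1 < j + 2)] at h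
    exact ⟨h.1, h.2.1, h.2.2 (by simp)⟩
  have htower : IsTower T K fun j => topLevel K j (X j) := fun j => ⟨(key j).1, (key j).2.2⟩
  convert htower.isPositivePerfectSubtree hT using 1
  exact Set.iUnion_congr fun j => (key j).2.1.finSet_eq

/-- Any tower, however noncomputable, supplies a node of every length. -/
theorem infinite_approximations {T : Set (List Bool)} {K : ℕ} {M : ℕ → List (List Bool)}
    (hM : IsTower T K M) : (approximations T K).Infinite := by
  choose k hk using fun j => exists_isCodeOf (M j)
  refine Set.infinite_of_injective_forall_mem (f := fun n => (List.range n).map k)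
    (fun m n h => by simpa using congrArg List.length h) fun n i hi => ?_
  have hget : ∀ {i : ℕ}, i < n → ((List.range n).map k).getD i 0 = k i := fun h => by
    simp [List.getD, h]
  simp only [List.length_map, List.length_range, List.mem_range] at hi ⊢
  have hp : ∀ j, (M j).Perm (topLevel K j (k j)) := fun j => perm_topLevel (hM j).1 (hk j)
  rw [hget hi]
  refine ⟨(hM i).1.of_perm (hp i), (hk i).of_perm (hp i), fun h => ?_⟩
  rw [hget h]
  exact (hM i).2.of_perm (hp i) (hp (i + 1))

/-! ### Effectivity of the tree of approximations -/

theorem primrec_prefixes : Primrec prefixes :=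
  Primrec.list_flatMap Primrec.id (Primrec.list_map (Primrec.list_range.comp (Primrec.succ.comp
    (Primrec.list_length.comp Primrec.snd)))
    (Primrec.list_take.comp Primrec.snd (Primrec.snd.comp Primrec.fst)))

/-- The digits of the entry at place `i` sit at codes of strings of length at most `level K i`, a
finite set that does not depend on `T`. -/
theorem computablyBounded_approximations (T : Set (List Bool)) (K : ℕ) :
    ComputablyBounded (approximations T K) := by
  refine ⟨fun i => 2 ^ (((prefixes (strings (level K i))).map Encodable.encode).sum + 1),
    Primrec.to_comp ?_, fun s hs i hi => ?_⟩
  · exact Primrec.nat_pow.comp (Primrec.const 2) (Primrec.succ.comp (Primrec.list_sum.comp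
      (Primrec.list_map (primrec_prefixes.comp (primrec_strings.comp (primrec_level K)))
        (Primrec.encode.comp Primrec.snd))))
  · obtain ⟨-, h, -⟩ := hs i (List.mem_range.2 hi)
    rw [List.getD_eq_getElem _ _ hi] at h
    refine (Nat.lt_pow_two_of_testBit _ fun n hn => ?_).le
    by_contra hbit
    rw [Bool.not_eq_false] at hbit
    obtain ⟨σ, hσ, rfl⟩ := h.2 n (List.mem_range.2 (lt_of_testBit hbit)) hbit
    refine absurd (List.lt_sum_add_one_of_mem (List.mem_map_of_mem ?_)) hn.not_gt
    rw [mem_prefixes] at hσ ⊢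
    obtain ⟨τ, hτ, hστ⟩ := hσ
    exact ⟨τ, (List.mem_filter.1 hτ).1, hστ⟩

theorem primrec_topLevel (K : ℕ) : Primrec₂ (topLevel K) :=
  Primrec.list_filter (primrec_strings.comp ((primrec_level K).comp Primrec.fst))
    (Primrec.nat_testBit.comp (Primrec.snd.comp Primrec.fst) (Primrec.encode.comp Primrec.snd))

theorem primrecRel_isCodeOf : PrimrecRel IsCodeOf := by
  have hpre : Primrec fun x : ℕ × List (List Bool) => prefixes x.2 :=
    primrec_prefixes.comp Primrec.snd
  refine PrimrecPred.and (PrimrecPred.ball hpre ?_)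
    (PrimrecPred.ball (Primrec.list_range.comp Primrec.fst) (PrimrecPred.imp ?_ ?_))
  · exact Primrec.eq.comp (Primrec.nat_testBit.comp (Primrec.fst.comp Primrec.fst)
      (Primrec.encode.comp Primrec.snd)) (Primrec.const true)
  · exact Primrec.eq.comp (Primrec.nat_testBit.comp (Primrec.fst.comp Primrec.fst) Primrec.snd)
      (Primrec.const true)
  · exact PrimrecPred.bex (hpre.comp Primrec.fst)
      (Primrec.eq.comp (Primrec.encode.comp Primrec.snd) (Primrec.snd.comp Primrec.fst))

theorem primrecPred_isTowerStep (K : ℕ) :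
    PrimrecPred fun x : ℕ × List (List Bool) × List (List Bool) =>
      IsTowerStep K x.1 x.2.1 x.2.2 := by
  have hM : Primrec fun x : (ℕ × List (List Bool) × List (List Bool)) × List Bool => x.1.2.1 :=
    Primrec.fst.comp (Primrec.snd.comp Primrec.fst)
  refine (PrimrecPred.and (PrimrecPred.ball (Primrec.snd.comp Primrec.snd) ?_)
    (PrimrecPred.ball (Primrec.fst.comp Primrec.snd) ?_)).of_eq fun x => isTowerStep_iff.symm
  · refine (PrimrecPred.bex hM (p := fun y σ => σ = y.2.take (level K y.1.1)) ?_).of_eq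
      fun y => by simp
    exact Primrec.eq.comp Primrec.snd (Primrec.list_take.comp ((primrec_level K).comp
      (Primrec.fst.comp (Primrec.fst.comp Primrec.fst))) (Primrec.snd.comp Primrec.fst))
  · exact Primrec.nat_le.comp (Primrec.const 2) (Primrec.list_countP
      (Primrec.snd.comp (Primrec.snd.comp Primrec.fst))
      (primrecRel_isPrefix.decide.comp (Primrec.snd.comp Primrec.fst) Primrec.snd))

theorem setReducible_approximations (T : Set (List Bool)) (K : ℕ) :
    SetReducible (codes (approximations T K)) (codes T) := by
  -- Only members of the coded finite sets are queried, and the code of a member of `finSet k` is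
  -- below `k`.
  have hu : Primrec fun s : List ℕ => s.sum + 1 := Primrec.succ.comp Primrec.list_sum
  have hR : PrimrecRel fun (s : List ℕ) (l : List Bool) => ∀ i ∈ List.range s.length,
      ((∀ σ ∈ topLevel K i (s.getD i 0), l.getD (Encodable.encode σ) false = true) ∧
        2 ^ level K i ≤ 2 ^ K * (topLevel K i (s.getD i 0)).length) ∧
      IsCodeOf (s.getD i 0) (topLevel K i (s.getD i 0)) ∧
      (i + 1 < s.length → IsTowerStep K i (topLevel K i (s.getD i 0))
        (topLevel K (i + 1) (s.getD (i + 1) 0))) := by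
    have hs : Primrec fun x : (List ℕ × List Bool) × ℕ => x.1.1 := Primrec.fst.comp Primrec.fst
    have hi : Primrec fun x : (List ℕ × List Bool) × ℕ => x.2 := Primrec.snd
    have hk := (Primrec.list_getD 0).comp hs hi
    have hk' := (Primrec.list_getD 0).comp hs (Primrec.succ.comp hi)
    have ht := (primrec_topLevel K).comp hi hk
    have ht' := (primrec_topLevel K).comp (Primrec.succ.comp hi) hk'
    refine PrimrecPred.ball (Primrec.list_range.comp (Primrec.list_length.comp Primrec.fst))
      (PrimrecPred.and (PrimrecPred.and (PrimrecPred.ball ht ?_) ?_)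
        (PrimrecPred.and (primrecRel_isCodeOf.comp hk ht) (PrimrecPred.imp ?_ ?_)))
    · exact Primrec.eq.comp (primrec_oracle_getD
        (Primrec.snd.comp (Primrec.fst.comp Primrec.fst)) Primrec.snd) (Primrec.const true)
    · exact Primrec.nat_le.comp (Primrec.nat_pow.comp (Primrec.const 2) ((primrec_level K).comp hi))
        (Primrec.nat_mul.comp (Primrec.const (2 ^ K)) (Primrec.list_length.comp ht))
    · exact Primrec.nat_lt.comp (Primrec.succ.comp hi) (Primrec.list_length.comp hs)
    · exact (primrecPred_isTowerStep K).comp (Primrec.pair hi (Primrec.pair ht ht'))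
  refine .of_segment_rel (.refl _) hu hR fun s => ?_
  refine forall₂_congr fun i hi => and_congr_left' ?_
  rw [isTowerLevel_topLevel_iff]
  refine and_congr_left' (forall₂_congr fun σ hσ => ?_)
  rw [segment_getD, encode_mem_codes]
  have hi := List.mem_range.1 hi
  refine (lt_of_testBit (mem_topLevel.1 hσ).2).trans (List.lt_sum_add_one_of_mem ?_)
  rw [List.getD_eq_getElem _ _ hi]
  exact List.getElem_mem hi

end PerfTree

theorem corollary2p3 (T : Set (List Bool)) (hT : IsTree T) (hpos : IsPositive T) :
    (∃ F : Set (List ℕ),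
      IsTreeOfFiniteSubtrees F T ∧ F.Infinite ∧
      SetReducible (codes F) (codes T) ∧ ComputablyBounded F ∧
      ∀ X ∈ paths F, IsPositivePerfectSubtree (pathUnion X) T) ∧
    (∀ A : Set ℕ, SetReducible (jump (codes T)) A →
      ∃ P : Set (List Bool), IsPositivePerfectSubtree P T ∧
        SetEquivalent A (join (codes T) (codes P))) := by
  refine ⟨?_, fun A hA => exists_positivePerfectSubtree_equivalent hT hpos hA⟩
  obtain ⟨K, hK⟩ := exists_weight_bound hpos
  exact ⟨approximations T K, isTreeOfFiniteSubtrees_approximations hT K,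
    -- Any choice of parities would do here.
    infinite_approximations (exists_codedTower hT hK fun _ => false),
    setReducible_approximations T K, computablyBounded_approximations T K,
    fun X hX => isPositivePerfectSubtree_pathUnion hT hX⟩
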